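/- Let $\mathcal X$ be the (countable) set of configurations $\eta\in\{0,1\}^{\mathbb Z}$ with $\sum_{x\ge 0}\eta(x)<\infty$ and $\sum_{x\le 0}(1-\eta(x))<\infty$, identified with their sets of occupied sites. For $\eta\in\mathcal X$ let $R(\eta)=\max\{x:\eta(x)=1\}$ be the rightmost particle, $L(\eta)=\min\{x:\eta(x)=0\}$ the leftmost hole, and let the median $M(\eta)$ be the unique $m\in\mathbb Z+\frac12$ with $\sum_{x>m}\eta(x)=\sum_{x<m}(1-\eta(x))$. Put $\mathcal X^0=\{\eta\in\mathcal X: M(\eta)=\frac12\}$. For $J>0$ let $(\eta_t)_{t\ge0}$ be the continuous-time Markov chain on $\mathcal X$ with generator $$Lf(\eta)=\sum_{x\in\mathbb Z}\tfrac12\big[f(\eta^{x,x+1})-f(\eta)\big]+J\big[f(\eta\setminus\{R(\eta)\})-f(\eta)\big]+J\big[f(\eta\cup\{L(\eta)\})-f(\eta)\big],$$ where $\eta^{x,x+1}$ is $\eta$ with the contents of $x$ and $x+1$ exchanged; that is, the minimal chain with the jump rates given by $L$. Let the process seen from the median be $\tilde\eta_t\in\mathcal X^0$, $\tilde\eta_t(x)=\eta_t\big(x+M(\eta_t)-\tfrac12\big)$,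 with $\tilde\eta_0=\eta_0\in\mathcal X^0$. Theorem. For every $J>0$, the chain $(\eta_t)$ does not explode (from every initial configuration in $\mathcal X$ its law at each time $t\ge0$ is a probability measure on $\mathcal X$), the process $(\tilde\eta_t)$ has a unique invariant probability measure $\mu_J$ on $\mathcal X^0$ (a probability measure such that $\tilde\eta_0\sim\mu_J$ implies $\tilde\eta_t\sim\mu_J$ for all $t\ge 0$), the function $R-L+1$ is $\mu_J$-integrable, and $$\int_{\mathcal X^0}\big(R(\eta)-L(\eta)+1\big)\,\mu_J(d\eta)=\frac1{2J}.$$ -/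

import Mathlib

open MeasureTheory ProbabilityTheory
open scoped ENNReal Classical

namespace FreeBoundary

noncomputable section

/-! ### Minimal transition functions of continuous-time Markov chains -/

/-- Total rate at which a chain with off-diagonal jump rates `q` leaves the state `x`. -/
def exitRate {S : Type*} (q : S → S → ℝ≥0∞) (x : S) : ℝ≥0∞ := ∑' y, q x y

/-- `killedTransition q n t x y` is the probability that the chain with jump rates `q`, started
at `x`, is at `y` at time `t` and has made fewer than `n` jumps up to time `t`. The recursion
conditions on the time `s` of the first jump and on the state `z` it leads to; the holding time
at `x` is exponential with parameter `exitRate q x`. -/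
def killedTransition {S : Type*} (q : S → S → ℝ≥0∞) : ℕ → ℝ → S → S → ℝ≥0∞
  | 0, _, _, _ => 0
  | n + 1, t, x, y =>
      (if x = y then ENNReal.ofReal (Real.exp (-((exitRate q x).toReal * t))) else 0) +
        ∫⁻ s in Set.Icc 0 t, ENNReal.ofReal (Real.exp (-((exitRate q x).toReal * s))) *
          ∑' z, q x z * killedTransition q n (t - s) z y

/-- The transition probabilities of the (minimal) continuous-time Markov chain with
jump rates `q`. -/
def transitionProb {S : Type*} (q : S → S → ℝ≥0∞) (t : ℝ) (x y : S) : ℝ≥0∞ :=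
  ⨆ n, killedTransition q n t x y

/-! ### Particle configurations -/

/-- The space of configurations: a configuration is identified with its set of occupied sites;
there are finitely many particles to the right of the origin and finitely many holes to its
left. -/
def Config : Type :=
  {η : Set ℤ // {x : ℤ | 0 ≤ x ∧ x ∈ η}.Finite ∧ {x : ℤ | x ≤ 0 ∧ x ∉ η}.Finite}

/-- The configuration space is countable; it carries the discrete `σ`-algebra. -/
instance : MeasurableSpace Config := ⊤

theorem Config.finite_particles (η : Config) (k : ℤ) : {x : ℤ | k < x ∧ x ∈ η.1}.Finite := by
  refine (η.2.1.union (Set.finite_Icc k 0)).subset ?_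
  rintro x ⟨hx, hxη⟩
  by_cases h : 0 ≤ x
  · exact Or.inl ⟨h, hxη⟩
  · exact Or.inr ⟨hx.le, by omega⟩

theorem Config.finite_holes (η : Config) (k : ℤ) : {x : ℤ | x ≤ k ∧ x ∉ η.1}.Finite := by
  refine (η.2.2.union (Set.finite_Icc 0 k)).subset ?_
  rintro x ⟨hx, hxη⟩
  by_cases h : x ≤ 0
  · exact Or.inl ⟨h, hxη⟩
  · exact Or.inr ⟨by omega, hx⟩

/-- Position of the rightmost particle. -/
def rightmost (η : Config) : ℤ := sSup η.1

/-- Position of the leftmost hole. -/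
def leftmost (η : Config) : ℤ := sInf (η.1)ᶜ

/-- Exchange of the contents of the sites `x` and `x + 1`. -/
def exchange (η : Config) (x : ℤ) : Config :=
  ⟨{y | Equiv.swap x (x + 1) y ∈ η.1}, by
    constructor
    · refine (η.2.1.union (Set.toFinite {x, x + 1})).subset ?_
      rintro y ⟨hy, hyη⟩
      by_cases h : y = x ∨ y = x + 1
      · exact Or.inr h
      · rw [not_or] at h
        rw [Set.mem_ofPred_eq, Equiv.swap_apply_of_ne_of_ne h.1 h.2] at hyη
        exact Or.inl ⟨hy, hyη⟩
    · refine (η.2.2.union (Set.toFinite {x, x + 1})).subset ?_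
      rintro y ⟨hy, hyη⟩
      by_cases h : y = x ∨ y = x + 1
      · exact Or.inr h
      · rw [not_or] at h
        rw [Set.mem_ofPred_eq, Equiv.swap_apply_of_ne_of_ne h.1 h.2] at hyη
        exact Or.inl ⟨hy, hyη⟩⟩

/-- Birth of a particle at the leftmost hole. -/
def birth (η : Config) : Config :=
  ⟨η.1 ∪ {leftmost η}, by
    constructor
    · refine (η.2.1.union (Set.finite_singleton (leftmost η))).subset ?_
      rintro y ⟨hy, hyη | hyη⟩
      · exact Or.inl ⟨hy, hyη⟩
      · exact Or.inr hyη
    · exact η.2.2.subset fun y hy => ⟨hy.1, fun h => hy.2 (Or.inl h)⟩⟩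

/-- Death of the rightmost particle. -/
def death (η : Config) : Config :=
  ⟨η.1 \ {rightmost η}, by
    constructor
    · exact η.2.1.subset fun y hy => ⟨hy.1, hy.2.1⟩
    · refine (η.2.2.union (Set.finite_singleton (rightmost η))).subset ?_
      rintro y ⟨hy, hyη⟩
      by_cases h : y = rightmost η
      · exact Or.inr h
      · exact Or.inl ⟨hy, fun h' => hyη ⟨h', h⟩⟩⟩

/-! ### The particle process -/

/-- Generator of the symmetric simple exclusion process at rate `1/2`. All but finitely many
terms of the sum vanish. -/
def exclusionGenerator (f : Config → ℝ) (η : Config) : ℝ :=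
  ∑' x : ℤ, (1 / 2 : ℝ) * (f (exchange η x) - f η)

/-- Generator of the births at the leftmost hole at rate `J`. -/
def birthGenerator (J : ℝ) (f : Config → ℝ) (η : Config) : ℝ := J * (f (birth η) - f η)

/-- Generator of the deaths of the rightmost particle at rate `J`. -/
def deathGenerator (J : ℝ) (f : Config → ℝ) (η : Config) : ℝ := J * (f (death η) - f η)

/-- Generator of the particle process. -/
def generator (J : ℝ) (f : Config → ℝ) (η : Config) : ℝ :=
  exclusionGenerator f η + deathGenerator J f η + birthGenerator J f η

/-- The rate at which the particle process jumps from `η` to `ζ ≠ η`, read off its generator. -/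
def jumpRate (J : ℝ) (η ζ : Config) : ℝ≥0∞ :=
  if ζ = η then 0 else ENNReal.ofReal (generator J (fun ξ => if ξ = ζ then 1 else 0) η)

/-- The law of the particle process at time `t` when started from `η`. -/
def particleLaw (J : ℝ) (t : ℝ) (η : Config) : Measure Config :=
  Measure.sum fun ζ => transitionProb (jumpRate J) t η ζ • Measure.dirac ζ

/-! ### The process seen from the median -/

/-- Number of particles to the right of `k + 1/2` minus number of holes to its left. -/
def excess (η : Config) (k : ℤ) : ℤ :=
  ({x : ℤ | k < x ∧ x ∈ η.1}.ncard : ℤ) - ({x : ℤ | x ≤ k ∧ x ∉ η.1}.ncard : ℤ)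

theorem excess_succ (η : Config) (k : ℤ) : excess η (k + 1) = excess η k - 1 := by
  unfold excess
  by_cases h : k + 1 ∈ η.1
  · have h1 : {x : ℤ | k < x ∧ x ∈ η.1} = insert (k + 1) {x : ℤ | k + 1 < x ∧ x ∈ η.1} := by
      ext x
      simp only [Set.mem_insert_iff, Set.mem_ofPred_eq]
      constructor
      · rintro ⟨hx, hxη⟩
        by_cases hk : x = k + 1
        · exact Or.inl hk
        · exact Or.inr ⟨by omega, hxη⟩
      · rintro (rfl | ⟨hx, hxη⟩)
        · exact ⟨by omega, h⟩
        · exact ⟨by omega, hxη⟩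
    have h2 : {x : ℤ | x ≤ k + 1 ∧ x ∉ η.1} = {x : ℤ | x ≤ k ∧ x ∉ η.1} := by
      ext x
      simp only [Set.mem_ofPred_eq]
      constructor
      · rintro ⟨hx, hxη⟩
        have : x ≠ k + 1 := fun e => hxη (e ▸ h)
        exact ⟨by omega, hxη⟩
      · rintro ⟨hx, hxη⟩
        exact ⟨by omega, hxη⟩
    rw [h1, h2, Set.ncard_insert_of_notMem (by simp) (η.finite_particles _)]
    push_cast
    ring
  · have h1 : {x : ℤ | x ≤ k + 1 ∧ x ∉ η.1} = insert (k + 1) {x : ℤ | x ≤ k ∧ x ∉ η.1} := by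
      ext x
      simp only [Set.mem_insert_iff, Set.mem_ofPred_eq]
      constructor
      · rintro ⟨hx, hxη⟩
        by_cases hk : x = k + 1
        · exact Or.inl hk
        · exact Or.inr ⟨by omega, hxη⟩
      · rintro (rfl | ⟨hx, hxη⟩)
        · exact ⟨by omega, h⟩
        · exact ⟨by omega, hxη⟩
    have h2 : {x : ℤ | k < x ∧ x ∈ η.1} = {x : ℤ | k + 1 < x ∧ x ∈ η.1} := by
      ext x
      simp only [Set.mem_ofPred_eq]
      constructor
      · rintro ⟨hx, hxη⟩
        have : x ≠ k + 1 := fun e => h (e ▸ hxη)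
        exact ⟨by omega, hxη⟩
      · rintro ⟨hx, hxη⟩
        exact ⟨by omega, hxη⟩
    rw [h1, h2, Set.ncard_insert_of_notMem (by simp) (η.finite_holes _)]
    push_cast
    ring

theorem excess_eq (η : Config) (k : ℤ) : excess η k = excess η 0 - k := by
  induction k using Int.induction_on with
  | zero => simp
  | succ i ih => rw [excess_succ, ih]; ring
  | pred i ih =>
    have := excess_succ η (-(i : ℤ) - 1)
    rw [sub_add_cancel, ih] at this
    omega

theorem existsUnique_median (η : Config) : ∃! k : ℤ, excess η k = 0 :=
  ⟨excess η 0, (excess_eq η _).trans (sub_self _), fun k hk => by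
    have := excess_eq η k
    omega⟩

/-- The integer `k` such that the median of `η` is `k + 1/2`. -/
def medianFloor (η : Config) : ℤ := (existsUnique_median η).choose

/-- The median: the half-integer with as many particles to its right as holes to its left. -/
def median (η : Config) : ℚ := medianFloor η + 1 / 2

theorem medianFloor_eq_iff (η : Config) (k : ℤ) : medianFloor η = k ↔ excess η k = 0 :=
  ⟨fun h => h ▸ (existsUnique_median η).choose_spec.1,
    fun h => ((existsUnique_median η).choose_spec.2 k h).symm⟩

/-- The configuration `η` seen from the site `y`, that is, `x ↦ η (x + y)`. -/
def translate (y : ℤ) (η : Config) : Config :=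
  ⟨{x | x + y ∈ η.1}, by
    constructor
    · refine ((η.finite_particles (y - 1)).preimage
        (f := fun x => x + y) (add_left_injective y).injOn).subset ?_
      rintro x ⟨hx, hxη⟩
      exact ⟨show y - 1 < x + y by omega, hxη⟩
    · refine ((η.finite_holes y).preimage
        (f := fun x => x + y) (add_left_injective y).injOn).subset ?_
      rintro x ⟨hx, hxη⟩
      exact ⟨show x + y ≤ y by omega, hxη⟩⟩

theorem excess_translate (y : ℤ) (η : Config) (k : ℤ) :
    excess (translate y η) k = excess η (k + y) := by
  have h1 : {x : ℤ | k + y < x ∧ x ∈ η.1} =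
      (fun x => x + y) '' {x : ℤ | k < x ∧ x ∈ (translate y η).1} := by
    ext x
    constructor
    · rintro ⟨hx, hxη⟩
      refine ⟨x - y, ⟨by omega, ?_⟩, by simp⟩
      change x - y + y ∈ η.1
      rwa [sub_add_cancel]
    · rintro ⟨z, ⟨hz, hzη⟩, rfl⟩
      exact ⟨show k + y < z + y by omega, hzη⟩
  have h2 : {x : ℤ | x ≤ k + y ∧ x ∉ η.1} =
      (fun x => x + y) '' {x : ℤ | x ≤ k ∧ x ∉ (translate y η).1} := by
    ext x
    constructor
    · rintro ⟨hx, hxη⟩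
      refine ⟨x - y, ⟨by omega, ?_⟩, by simp⟩
      change x - y + y ∉ η.1
      rwa [sub_add_cancel]
    · rintro ⟨z, ⟨hz, hzη⟩, rfl⟩
      exact ⟨show z + y ≤ k + y by omega, hzη⟩
  unfold excess
  rw [h1, h2, Set.ncard_image_of_injective _ (add_left_injective y),
    Set.ncard_image_of_injective _ (add_left_injective y)]

/-- The configurations with median `1/2`. -/
def CenteredConfig : Type := {η : Config // median η = 1 / 2}

instance : MeasurableSpace CenteredConfig := ⊤

/-- The configuration as seen from its median, translated so that the median becomes `1/2`. -/
def seenFromMedian (η : Config) : CenteredConfig :=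
  ⟨translate (medianFloor η) η, by
    have h : medianFloor (translate (medianFloor η) η) = 0 := by
      rw [medianFloor_eq_iff, excess_translate, zero_add, ← medianFloor_eq_iff]
    rw [median, h]
    norm_num⟩

/-- Transition kernel at time `t` of the particle process seen from the median: the particle
process is run for time `t` from a configuration with median `1/2` and then recentred. -/
def medianKernel (J t : ℝ) : Kernel CenteredConfig CenteredConfig where
  toFun η := (particleLaw J t η.1).map seenFromMedian
  measurable' := measurable_from_top

/-- `μ` is an invariant probability measure of the process seen from the median. -/
def IsInvariantProbability (J : ℝ) (μ : Measure CenteredConfig) : Prop :=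
  IsProbabilityMeasure μ ∧ ∀ t : ℝ, 0 ≤ t → (medianKernel J t).Invariant μ

end

end FreeBoundary

namespace FreeBoundary

/-! ### Integral identities -/

/-! The observable behind the theorem is the area: the number of pairs formed by a hole and a
particle to its right. A particle jump to the right adds one such pair, a jump to the left removes
one. Since a configuration is full far to the left and empty far to the right, there is exactly one
more possible right jump than left jump (`ncard_upSites`), so exclusion contributes `1/2` to the
drift. A death removes as many pairs as there are holes left of the rightmost particle, a birth as
many as there are particles right of the leftmost hole; together these count the `R - L + 1` sites
between the two (`ncard_inner`). Hence the generator sends the area to `1/2 - J (R - L + 1)`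
(`tsum_jumpRate_mul_area`), and a stationary mean drift of zero gives the mean width `1/(2J)`.

The same identity is a Foster–Lyapunov condition. With `1 + area` as Lyapunov function it bounds the
expected number of jumps, which excludes explosion. For existence, the chain is restricted to
sublevel sets of the area; the finite chains have stationary laws whose mean width is at most
`1/(2J)`, and since only finitely many centred configurations have a given width, these laws are
tight and have a limit (`exists_stationary`). The exit rate is at most the width plus a constant, so
its mean is finite. This makes the limit invariant for the semigroup (`stationary_invariant`), and
permits the balance of gain and loss of area without integrability of the area, by truncating it
(`stationary_balance`).

Uniqueness holds because successive deaths lead from every state to the single centred configuration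
of area zero, and the minimum of two invariant laws is again invariant (`invariant_unique`).
Translation invariance of the rates transfers everything to the process seen from the median. -/

theorem ofReal_exp_add (a b : ℝ) : ENNReal.ofReal (Real.exp (a + b)) =
    ENNReal.ofReal (Real.exp a) * ENNReal.ofReal (Real.exp b) := by
  rw [Real.exp_add, ENNReal.ofReal_mul (Real.exp_pos _).le]

theorem lintegral_exp_Icc {a r t : ℝ} (ha : 0 ≤ a) (hrt : r ≤ t) :
    ∫⁻ s in Set.Icc r t, ENNReal.ofReal a * ENNReal.ofReal (Real.exp (-(a * (s - r)))) =
      ENNReal.ofReal (1 - Real.exp (-(a * (t - r)))) := by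
  have hd : ∀ s : ℝ, HasDerivAt (fun s => -Real.exp (-(a * (s - r))))
      (a * Real.exp (-(a * (s - r)))) s := by
    intro s
    have h1 : HasDerivAt (fun s : ℝ => -(a * (s - r))) (-(a * 1)) s :=
      (((hasDerivAt_id s).sub_const r).const_mul a).neg
    refine h1.exp.fun_neg.congr_deriv ?_
    ring
  have hc : Continuous fun s => a * Real.exp (-(a * (s - r))) := by fun_prop
  have hi : ∫ s in r..t, a * Real.exp (-(a * (s - r))) = 1 - Real.exp (-(a * (t - r))) := by
    rw [intervalIntegral.integral_eq_sub_of_hasDerivAt (fun s _ => hd s)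
      (hc.intervalIntegrable _ _)]
    simp
    ring
  rw [← hi, intervalIntegral.integral_of_le hrt, ← integral_Icc_eq_integral_Ioc,
    ofReal_integral_eq_lintegral_ofReal (hc.continuousOn.integrableOn_Icc)
      (Filter.Eventually.of_forall fun s => by positivity)]
  refine lintegral_congr fun s => ?_
  rw [ENNReal.ofReal_mul ha]

theorem lintegral_exp_Icc_add {a r t : ℝ} (ha : 0 ≤ a) (hrt : r ≤ t) :
    (∫⁻ s in Set.Icc r t, ENNReal.ofReal a * ENNReal.ofReal (Real.exp (-(a * (s - r))))) +
      ENNReal.ofReal (Real.exp (-(a * (t - r)))) = 1 := by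
  have h : Real.exp (-(a * (t - r))) ≤ 1 :=
    Real.exp_le_one_iff.2 (neg_nonpos.2 (mul_nonneg ha (sub_nonneg.2 hrt)))
  rw [lintegral_exp_Icc ha hrt, ← ENNReal.ofReal_add (sub_nonneg.2 h) (Real.exp_pos _).le,
    sub_add_cancel, ENNReal.ofReal_one]

theorem setLIntegral_Icc_reflect (t : ℝ) (f : ℝ → ℝ≥0∞) :
    ∫⁻ s in Set.Icc 0 t, f (t - s) = ∫⁻ s in Set.Icc 0 t, f s := by
  rw [← lintegral_indicator measurableSet_Icc, ← lintegral_indicator measurableSet_Icc,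
    ← lintegral_sub_left_eq_self _ t]
  refine lintegral_congr fun s => ?_
  simp only [Set.indicator, Set.mem_Icc, sub_nonneg, sub_le_self_iff]
  rw [sub_sub_cancel]
  simp only [and_comm]

theorem measurable_setLIntegral_Icc {f : ℝ → ℝ → ℝ≥0∞} (hf : Measurable (Function.uncurry f)) :
    Measurable fun t => ∫⁻ s in Set.Icc 0 t, f t s := by
  have h : Measurable (Set.indicator {p : ℝ × ℝ | 0 ≤ p.2 ∧ p.2 ≤ p.1} (Function.uncurry f)) :=
    hf.indicator ((measurableSet_le measurable_const measurable_snd).inter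
      (measurableSet_le measurable_snd measurable_fst))
  convert h.lintegral_prod_right' (ν := volume) using 2 with t
  rw [← lintegral_indicator measurableSet_Icc]
  rfl

theorem lintegral_triangle {f : ℝ → ℝ → ℝ≥0∞} (hf : Measurable (Function.uncurry f)) (t : ℝ) :
    ∫⁻ s in Set.Icc 0 t, ∫⁻ r in Set.Icc 0 s, f s r =
      ∫⁻ r in Set.Icc 0 t, ∫⁻ s in Set.Icc r t, f s r := by
  have h : Measurable (Set.indicator {p : ℝ × ℝ | (0 ≤ p.2 ∧ p.2 ≤ p.1) ∧ p.1 ≤ t}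
      (Function.uncurry f)) :=
    hf.indicator (((measurableSet_le measurable_const measurable_snd).inter
      (measurableSet_le measurable_snd measurable_fst)).inter
      (measurableSet_le measurable_fst measurable_const))
  have h1 : ∀ s r, Set.indicator {p : ℝ × ℝ | (0 ≤ p.2 ∧ p.2 ≤ p.1) ∧ p.1 ≤ t}
      (Function.uncurry f) (s, r) = if (0 ≤ r ∧ r ≤ s) ∧ s ≤ t then f s r else 0 :=
    fun s r => by rw [Set.indicator_apply]; rfl
  have h2 := lintegral_lintegral_swap (μ := volume) (ν := volume)
    (f := fun s r => Set.indicator {p : ℝ × ℝ | (0 ≤ p.2 ∧ p.2 ≤ p.1) ∧ p.1 ≤ t}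
      (Function.uncurry f) (s, r)) h.aemeasurable
  simp only [← lintegral_indicator measurableSet_Icc]
  calc _ = _ := lintegral_congr fun s => ?_
    _ = _ := h2
    _ = _ := lintegral_congr fun r => ?_
  · by_cases hs : s ∈ Set.Icc 0 t
    · rw [Set.indicator_of_mem hs]
      refine lintegral_congr fun r => ?_
      rw [h1]
      simp [Set.indicator, hs.2]
    · rw [Set.indicator_of_notMem hs, eq_comm, lintegral_eq_zero_iff' (by fun_prop)]
      refine Filter.Eventually.of_forall fun r => ?_
      refine (h1 _ _).trans (if_neg ?_)
      rintro ⟨⟨h1, h2⟩, h3⟩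
      exact hs ⟨h1.trans h2, h3⟩
  · by_cases hr : r ∈ Set.Icc 0 t
    · rw [Set.indicator_of_mem hr]
      refine lintegral_congr fun s => ?_
      rw [h1]
      simp [Set.indicator, hr.1]
    · rw [Set.indicator_of_notMem hr, lintegral_eq_zero_iff' (by fun_prop)]
      refine Filter.Eventually.of_forall fun s => ?_
      refine (h1 _ _).trans (if_neg ?_)
      rintro ⟨⟨h1, h2⟩, h3⟩
      exact hr ⟨h1, h2.trans h3⟩

/-- Variation of constants: the mild form of `u' = v - a u`, `u 0 = c` implies the integrated
form. -/
theorem integrated_of_mild {a : ℝ} (ha : 0 ≤ a) {c : ℝ≥0∞} {u v : ℝ → ℝ≥0∞} (hv : Measurable v)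
    (hu : ∀ t, 0 ≤ t → u t = ENNReal.ofReal (Real.exp (-(a * t))) * c +
      ∫⁻ s in Set.Icc 0 t, ENNReal.ofReal (Real.exp (-(a * s))) * v (t - s))
    {t : ℝ} (ht : 0 ≤ t) :
    u t + ∫⁻ s in Set.Icc 0 t, ENNReal.ofReal a * u s = c + ∫⁻ s in Set.Icc 0 t, v s := by
  have hu' : ∀ t, 0 ≤ t → u t = ENNReal.ofReal (Real.exp (-(a * (t - 0)))) * c +
      ∫⁻ s in Set.Icc 0 t, ENNReal.ofReal (Real.exp (-(a * (t - s)))) * v s := by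
    intro t ht
    rw [hu t ht, ← setLIntegral_Icc_reflect]
    simp
  have h1 : ∫⁻ s in Set.Icc 0 t, ENNReal.ofReal a * u s =
      ∫⁻ s in Set.Icc 0 t, (ENNReal.ofReal a * ENNReal.ofReal (Real.exp (-(a * (s - 0)))) * c +
        ∫⁻ r in Set.Icc 0 s,
          ENNReal.ofReal a * ENNReal.ofReal (Real.exp (-(a * (s - r)))) * v r) := by
    refine setLIntegral_congr_fun measurableSet_Icc fun s hs => ?_
    simp only [mul_assoc]
    rw [lintegral_const_mul _ (by fun_prop), hu' s hs.1, mul_add]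
  rw [h1, lintegral_add_left (by fun_prop), lintegral_mul_const _ (by fun_prop), hu' t ht,
    lintegral_triangle (f := fun s r =>
      ENNReal.ofReal a * ENNReal.ofReal (Real.exp (-(a * (s - r)))) * v r) (by
        unfold Function.uncurry; fun_prop)]
  have h2 : ∀ r ∈ Set.Icc 0 t, ∫⁻ s in Set.Icc r t,
      ENNReal.ofReal a * ENNReal.ofReal (Real.exp (-(a * (s - r)))) * v r =
      (∫⁻ s in Set.Icc r t,
        ENNReal.ofReal a * ENNReal.ofReal (Real.exp (-(a * (s - r))))) * v r :=
    fun r _ => lintegral_mul_const _ (by fun_prop)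
  -- Mass entering at time `r` has either left by time `t` or is still present; `1` is split as the
  -- sum of these two exponential weights.
  have h3 : ∫⁻ s in Set.Icc 0 t, v s =
      ∫⁻ r in Set.Icc 0 t, (ENNReal.ofReal (Real.exp (-(a * (t - r)))) * v r +
      ∫⁻ s in Set.Icc r t,
        ENNReal.ofReal a * ENNReal.ofReal (Real.exp (-(a * (s - r)))) * v r) := by
    refine setLIntegral_congr_fun measurableSet_Icc fun r hr => ?_
    rw [h2 r hr, ← add_mul, add_comm, lintegral_exp_Icc_add ha hr.2, one_mul]
  rw [h3, lintegral_add_left (by fun_prop)]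
  have h4 := lintegral_exp_Icc_add ha ht
  calc _ = ((∫⁻ s in Set.Icc 0 t, ENNReal.ofReal a * ENNReal.ofReal (Real.exp (-(a * (s - 0))))) +
      ENNReal.ofReal (Real.exp (-(a * (t - 0))))) * c +
      ((∫⁻ s in Set.Icc 0 t, ENNReal.ofReal (Real.exp (-(a * (t - s)))) * v s) +
        ∫⁻ r in Set.Icc 0 t, ∫⁻ s in Set.Icc r t,
          ENNReal.ofReal a * ENNReal.ofReal (Real.exp (-(a * (s - r)))) * v r) := by
        rw [add_mul]; abel
    _ = _ := by rw [h4, one_mul]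

/-! ### Action of the minimal transition function on functions -/

section Chain

variable {S : Type*} (q : S → S → ℝ≥0∞)

theorem killedTransition_succ (n : ℕ) (t : ℝ) (x y : S) : killedTransition q (n + 1) t x y =
    (if x = y then ENNReal.ofReal (Real.exp (-((exitRate q x).toReal * t))) else 0) +
        ∫⁻ s in Set.Icc 0 t, ENNReal.ofReal (Real.exp (-((exitRate q x).toReal * s))) *
          ∑' z, q x z * killedTransition q n (t - s) z y := rfl

theorem killedTransition_le_succ (n : ℕ) (t : ℝ) (x y : S) :
    killedTransition q n t x y ≤ killedTransition q (n + 1) t x y := by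
  induction n generalizing t x y with
  | zero => exact zero_le
  | succ n ih =>
    rw [killedTransition_succ, killedTransition_succ]
    gcongr
    exact ih _ _ _

theorem monotone_killedTransition (t : ℝ) (x y : S) :
    Monotone fun n => killedTransition q n t x y :=
  monotone_nat_of_le_succ fun n => killedTransition_le_succ q n t x y

/-- Expectation of `f` at time `t` on the event that there were fewer than `n` jumps. -/
noncomputable def killedMean (f : S → ℝ≥0∞) (n : ℕ) (t : ℝ) (x : S) : ℝ≥0∞ :=
  ∑' y, killedTransition q n t x y * f y

/-- Expectation of `f` at time `t`. -/
noncomputable def transitionMean (f : S → ℝ≥0∞) (t : ℝ) (x : S) : ℝ≥0∞ :=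
  ∑' y, transitionProb q t x y * f y

theorem monotone_killedMean (f : S → ℝ≥0∞) (t : ℝ) (x : S) :
    Monotone fun n => killedMean q f n t x :=
  fun _ _ h => ENNReal.tsum_le_tsum fun y => mul_le_mul_left (monotone_killedTransition q t x y h) _

theorem tsum_iSup_of_monotone {ι : Type*} {f : ℕ → ι → ℝ≥0∞} (hf : ∀ i, Monotone fun n => f n i) :
    ∑' i, ⨆ n, f n i = ⨆ n, ∑' i, f n i := by
  let _ : MeasurableSpace ι := ⊤
  simp only [← lintegral_count]
  exact lintegral_iSup (fun n => measurable_from_top) fun m n h i => hf i h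

theorem transitionMean_eq_iSup (f : S → ℝ≥0∞) (t : ℝ) (x : S) :
    transitionMean q f t x = ⨆ n, killedMean q f n t x := by
  simp only [transitionMean, transitionProb, killedMean, ENNReal.iSup_mul]
  exact tsum_iSup_of_monotone fun y _ _ h =>
    mul_le_mul_left (monotone_killedTransition q t x y h) _

variable [Countable S]

theorem measurable_killedTransition (n : ℕ) (x y : S) :
    Measurable fun t => killedTransition q n t x y := by
  induction n generalizing x y with
  | zero => exact measurable_const
  | succ n ih =>
    simp only [killedTransition_succ]
    refine Measurable.add ?_ (measurable_setLIntegral_Icc ?_)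
    · split_ifs <;> fun_prop
    · refine Measurable.mul (by fun_prop) (Measurable.tsum fun z => ?_)
      exact ((ih z y).comp (measurable_fst.sub measurable_snd)).const_mul _

theorem measurable_killedMean (f : S → ℝ≥0∞) (n : ℕ) (x : S) :
    Measurable fun t => killedMean q f n t x :=
  Measurable.tsum fun y => (measurable_killedTransition q n x y).mul_const _

theorem measurable_transitionMean (f : S → ℝ≥0∞) (x : S) :
    Measurable fun t => transitionMean q f t x := by
  simp only [transitionMean_eq_iSup]
  exact Measurable.iSup fun n => measurable_killedMean q f n x

theorem killedMean_succ (f : S → ℝ≥0∞) (n : ℕ) (t : ℝ) (x : S) :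
    killedMean q f (n + 1) t x = ENNReal.ofReal (Real.exp (-((exitRate q x).toReal * t))) * f x +
      ∫⁻ s in Set.Icc 0 t, ENNReal.ofReal (Real.exp (-((exitRate q x).toReal * s))) *
          ∑' z, q x z * killedMean q f n (t - s) z := by
  have hm : ∀ z y, Measurable fun s => killedTransition q n (t - s) z y := fun z y =>
    (measurable_killedTransition q n z y).comp (by fun_prop)
  simp only [killedMean, killedTransition_succ, add_mul]
  rw [ENNReal.tsum_add]
  congr 1
  · rw [tsum_eq_single x (fun y hy => by rw [if_neg hy.symm, zero_mul]), if_pos rfl]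
  · rw [← setLIntegral_congr_fun (f := fun s =>
        ∑' y, ENNReal.ofReal (Real.exp (-((exitRate q x).toReal * s))) *
          (∑' z, q x z * killedTransition q n (t - s) z y) * f y)
      measurableSet_Icc (fun s _ => ?_), lintegral_tsum]
    rotate_left
    · intro y
      have := fun z => hm z y
      fun_prop
    · simp only [mul_assoc]
      rw [ENNReal.tsum_mul_left]
      congr 1
      simp only [← ENNReal.tsum_mul_right, ← ENNReal.tsum_mul_left]
      rw [ENNReal.tsum_comm]
      simp only [mul_assoc]
    · refine tsum_congr fun y => (lintegral_mul_const _ ?_).symm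
      have := fun z => hm z y
      fun_prop

/-- The first-jump recursion passes to the supremum over the number of jumps by monotone
convergence. -/
theorem transitionMean_mild (f : S → ℝ≥0∞) (t : ℝ) (x : S) :
    transitionMean q f t x = ENNReal.ofReal (Real.exp (-((exitRate q x).toReal * t))) * f x +
      ∫⁻ s in Set.Icc 0 t, ENNReal.ofReal (Real.exp (-((exitRate q x).toReal * s))) *
          ∑' z, q x z * transitionMean q f (t - s) z := by
  have hmono : ∀ s, Monotone fun n => ∑' z, q x z * killedMean q f n s z := fun s m n h =>
    ENNReal.tsum_le_tsum fun z => mul_le_mul_right (monotone_killedMean q f s z h) _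
  have h1 : ∀ s, ∑' z, q x z * transitionMean q f s z =
      ⨆ n, ∑' z, q x z * killedMean q f n s z := by
    intro s
    simp only [transitionMean_eq_iSup, ENNReal.mul_iSup]
    exact tsum_iSup_of_monotone fun z m n h => mul_le_mul_right (monotone_killedMean q f s z h) _
  have h2 : transitionMean q f t x = ⨆ n, killedMean q f (n + 1) t x := by
    rw [transitionMean_eq_iSup]
    exact ((monotone_killedMean q f t x).iSup_nat_add 1).symm
  rw [h2]
  simp only [h1, killedMean_succ, ENNReal.mul_iSup]
  rw [lintegral_iSup, ENNReal.add_iSup]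
  · intro n
    have := fun z => (measurable_killedMean q f n z)
    fun_prop
  · intro m n h s
    exact mul_le_mul_right (hmono _ h) _

/-- Kolmogorov's backward equation in integrated form; the loss term stands on the left because
`ℝ≥0∞` has no true subtraction. -/
theorem transitionMean_integrated (hq : ∀ x, exitRate q x ≠ ∞) (f : S → ℝ≥0∞) {t : ℝ} (ht : 0 ≤ t)
    (x : S) : transitionMean q f t x + ∫⁻ s in Set.Icc 0 t, exitRate q x * transitionMean q f s x =
      f x + ∫⁻ s in Set.Icc 0 t, ∑' z, q x z * transitionMean q f s z := by
  have h := integrated_of_mild (a := (exitRate q x).toReal) ENNReal.toReal_nonneg (c := f x)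
    (u := fun t => transitionMean q f t x) (v := fun s => ∑' z, q x z * transitionMean q f s z)
    (by have := measurable_transitionMean q f; fun_prop)
    (fun t _ => transitionMean_mild q f t x) ht
  simpa only [ENNReal.ofReal_toReal (hq x)] using h

/-! ### Non-explosion -/

/-- Probability of at least `n` jumps up to time `t`. -/
noncomputable def jumpTail : ℕ → ℝ → S → ℝ≥0∞
  | 0, _, _ => 1
  | n + 1, t, x =>
      ∫⁻ s in Set.Icc 0 t, ENNReal.ofReal (Real.exp (-((exitRate q x).toReal * s))) *
          ∑' z, q x z * jumpTail n (t - s) z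

theorem measurable_jumpTail (n : ℕ) (x : S) : Measurable fun t => jumpTail q n t x := by
  induction n generalizing x with
  | zero => exact measurable_const
  | succ n ih =>
    simp only [jumpTail]
    refine measurable_setLIntegral_Icc ?_
    refine Measurable.mul (by fun_prop) (Measurable.tsum fun z => ?_)
    exact ((ih z).comp (measurable_fst.sub measurable_snd)).const_mul _

theorem killedMean_one_add_jumpTail (hq : ∀ x, exitRate q x ≠ ∞) (n : ℕ) {t : ℝ} (ht : 0 ≤ t)
    (x : S) : killedMean q (fun _ => 1) n t x + jumpTail q n t x = 1 := by
  induction n generalizing t x with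
  | zero => simp [killedMean, killedTransition, jumpTail]
  | succ n ih =>
    have hm := measurable_killedMean q (fun _ => 1) n
    rw [killedMean_succ, jumpTail, add_assoc, ← lintegral_add_left (by fun_prop)]
    rw [setLIntegral_congr_fun (g := fun s => ENNReal.ofReal (exitRate q x).toReal *
      ENNReal.ofReal (Real.exp (-((exitRate q x).toReal * (s - 0))))) measurableSet_Icc
      fun s hs => ?_]
    · have := lintegral_exp_Icc_add (a := (exitRate q x).toReal) ENNReal.toReal_nonneg ht
      rw [mul_one, add_comm, ← this]
      simp only [sub_zero]
    · rw [← mul_add, ← ENNReal.tsum_add]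
      simp only [← mul_add, ih (sub_nonneg.2 hs.2), mul_one, sub_zero]
      rw [mul_comm, ENNReal.ofReal_toReal (hq x)]
      rfl

/-- The sum of the tails is a truncated expected number of jumps. The hypothesis says that the
generator applied to `W`, plus the rate of jumping, is at most `c W`, so `e^{ct} W` dominates this
expectation. -/
theorem sum_jumpTail_le (hq : ∀ x, exitRate q x ≠ ∞) {c : ℝ} (hc : 0 ≤ c) {W : S → ℝ≥0∞}
    (hW : ∀ x, exitRate q x + ∑' z, q x z * W z ≤ exitRate q x * W x + ENNReal.ofReal c * W x)
    (n : ℕ) {t : ℝ} (ht : 0 ≤ t) (x : S) :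
    ∑ k ∈ Finset.range n, jumpTail q (k + 1) t x ≤ ENNReal.ofReal (Real.exp (c * t)) * W x := by
  induction n generalizing t x with
  | zero => simp
  | succ n ih =>
    have hm := fun k => measurable_jumpTail q k
    set a := (exitRate q x).toReal with ha
    have ha0 : 0 ≤ a := ENNReal.toReal_nonneg
    have haq : exitRate q x = ENNReal.ofReal a := (ENNReal.ofReal_toReal (hq x)).symm
    simp only [jumpTail]
    rw [← lintegral_finsetSum _ (fun k _ => by have := hm k; fun_prop)]
    -- The product of `e^{-as}` and `e^{c(t-s)}` is `e^{ct} e^{-(a+c)s}`; the factor `a + c`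
    -- supplied by `hW` turns it into an exponential density, of mass at most one.
    calc _ ≤ ∫⁻ s in Set.Icc 0 t, (ENNReal.ofReal (a + c) *
          ENNReal.ofReal (Real.exp (-((a + c) * (s - 0))))) *
            (ENNReal.ofReal (Real.exp (c * t)) * W x) := by
          refine setLIntegral_mono' measurableSet_Icc fun s hs => ?_
          have hts : 0 ≤ t - s := sub_nonneg.2 hs.2
          rw [← Finset.mul_sum, ← Summable.tsum_finsetSum (fun _ _ => ENNReal.summable)]
          simp only [← Finset.mul_sum]
          -- The summand `1` counts the first jump; the induction hypothesis counts those after it.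
          have h1 : ∀ z, ∑ k ∈ Finset.range (n + 1), jumpTail q k (t - s) z ≤
              1 + ENNReal.ofReal (Real.exp (c * (t - s))) * W z := by
            intro z
            rw [Finset.sum_range_succ', add_comm]
            exact add_le_add le_rfl (ih hts z)
          have h2 : (1 : ℝ≥0∞) ≤ ENNReal.ofReal (Real.exp (c * (t - s))) := by
            rw [← ENNReal.ofReal_one]
            exact ENNReal.ofReal_le_ofReal (Real.one_le_exp (mul_nonneg hc hts))
          calc _ ≤ ENNReal.ofReal (Real.exp (-(a * s))) *
                ∑' z, q x z * (1 + ENNReal.ofReal (Real.exp (c * (t - s))) * W z) := by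
                gcongr with z; exact h1 z
            _ ≤ ENNReal.ofReal (Real.exp (-(a * s))) * (ENNReal.ofReal (Real.exp (c * (t - s))) *
                (exitRate q x + ∑' z, q x z * W z)) := by
                gcongr
                simp only [mul_add, mul_one]
                rw [ENNReal.tsum_add]
                simp only [mul_left_comm (q x _), ENNReal.tsum_mul_left]
                gcongr
                exact le_mul_of_one_le_left zero_le h2
            _ ≤ ENNReal.ofReal (Real.exp (-(a * s))) * (ENNReal.ofReal (Real.exp (c * (t - s))) *
                (ENNReal.ofReal (a + c) * W x)) := by
                gcongr
                rw [ENNReal.ofReal_add ha0 hc, add_mul, ← haq]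
                exact hW x
            _ = _ := by
                rw [← mul_assoc, ← ofReal_exp_add, show -(a * s) + c * (t - s) =
                  -((a + c) * (s - 0)) + c * t by ring, ofReal_exp_add]
                ring
      _ = (∫⁻ s in Set.Icc 0 t, (ENNReal.ofReal (a + c) *
          ENNReal.ofReal (Real.exp (-((a + c) * (s - 0)))))) *
            (ENNReal.ofReal (Real.exp (c * t)) * W x) := lintegral_mul_const _ (by fun_prop)
      _ ≤ 1 * (ENNReal.ofReal (Real.exp (c * t)) * W x) := by
          gcongr
          rw [← lintegral_exp_Icc_add (add_nonneg ha0 hc) ht]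
          exact le_add_of_nonneg_right zero_le
      _ = _ := one_mul _

/-- Foster–Lyapunov criterion for non-explosion. -/
theorem tsum_transitionProb_eq_one (hq : ∀ x, exitRate q x ≠ ∞) {c : ℝ} (hc : 0 ≤ c)
    {W : S → ℝ≥0∞} (hWtop : ∀ x, W x ≠ ∞)
    (hW : ∀ x, exitRate q x + ∑' z, q x z * W z ≤ exitRate q x * W x + ENNReal.ofReal c * W x)
    {t : ℝ} (ht : 0 ≤ t) (x : S) : ∑' y, transitionProb q t x y = 1 := by
  have h0 : ∑' y, transitionProb q t x y = ⨆ n, killedMean q (fun _ => 1) n t x := by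
    rw [← transitionMean_eq_iSup]; simp [transitionMean]
  have h1 : ∑' n, jumpTail q (n + 1) t x ≠ ∞ := by
    refine ne_top_of_le_ne_top (ENNReal.mul_ne_top (ENNReal.ofReal_ne_top (r := Real.exp (c * t))) (hWtop x)) ?_
    rw [ENNReal.tsum_eq_iSup_nat]
    exact iSup_le fun n => sum_jumpTail_le q hq hc hW n ht x
  -- Summable tails tend to zero, so no mass is lost to infinitely many jumps.
  have h2 := (Filter.tendsto_add_atTop_iff_nat (f := fun n => jumpTail q n t x) 1).1 (ENNReal.tendsto_atTop_zero_of_tsum_ne_top h1)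
  have h3 := (tendsto_atTop_iSup (monotone_killedMean q (fun _ => 1) t x)).add h2
  simp only [killedMean_one_add_jumpTail q hq _ ht x, add_zero] at h3
  rw [h0]
  exact tendsto_nhds_unique h3 tendsto_const_nhds

end Chain

/-! ### Stationary distributions -/

/-- The generator matrix annihilates constants, hence is singular and has a nonzero left null vector
`v`. The triangle inequality makes `|v|` subject to a one-sided balance at each state; both sides
have the same total, so equality holds everywhere. Irreducibility is not needed. -/
theorem exists_stationary_fintype {ι : Type*} [Fintype ι] [Nonempty ι] (A : ι → ι → ℝ)
    (hA : ∀ x y, 0 ≤ A x y) : ∃ v : ι → ℝ, (∀ x, 0 ≤ v x) ∧ ∑ x, v x = 1 ∧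
      ∀ y, ∑ x, v x * A x y = v y * ∑ z, A y z := by
  let M : Matrix ι ι ℝ := Matrix.of A - Matrix.diagonal fun x => ∑ z, A x z
  have hdet : M.det = 0 := by
    rw [← Matrix.exists_mulVec_eq_zero_iff]
    refine ⟨fun _ => 1, fun h => one_ne_zero (congrFun h (Classical.arbitrary ι)), ?_⟩
    ext x
    rw [Matrix.sub_mulVec, Pi.sub_apply, Matrix.mulVec_diagonal]
    simp [Matrix.mulVec, dotProduct]
  obtain ⟨v, hv0, hv⟩ := Matrix.exists_vecMul_eq_zero_iff.2 hdet
  have hbal : ∀ y, ∑ x, v x * A x y = v y * ∑ z, A y z := by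
    intro y
    have := congrFun hv y
    rw [Matrix.vecMul_sub, Pi.sub_apply, Matrix.vecMul_diagonal, Pi.zero_apply, sub_eq_zero] at this
    exact this
  have hle : ∀ y ∈ Finset.univ, |v y| * ∑ z, A y z ≤ ∑ x, |v x| * A x y := by
    intro y _
    calc |v y| * ∑ z, A y z = |∑ x, v x * A x y| := by
          rw [hbal, abs_mul, abs_of_nonneg (Finset.sum_nonneg fun z _ => hA y z)]
      _ ≤ ∑ x, |v x * A x y| := Finset.abs_sum_le_sum_abs _ _
      _ = _ := Finset.sum_congr rfl fun x _ => by rw [abs_mul, abs_of_nonneg (hA x y)]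
  have hsum : ∑ y, |v y| * ∑ z, A y z = ∑ y, ∑ x, |v x| * A x y := by
    rw [Finset.sum_comm]
    exact Finset.sum_congr rfl fun x _ => Finset.mul_sum _ _ _
  have heq := (Finset.sum_eq_sum_iff_of_le hle).1 hsum
  have hpos : 0 < ∑ x, |v x| := by
    refine lt_of_le_of_ne (Finset.sum_nonneg fun x _ => abs_nonneg _) fun h => hv0 ?_
    ext x
    have := (Finset.sum_eq_zero_iff_of_nonneg fun x _ => abs_nonneg (v x)).1 h.symm x
      (Finset.mem_univ x)
    exact abs_eq_zero.1 this
  refine ⟨fun x => |v x| / ∑ x, |v x|, fun x => by positivity, ?_, fun y => ?_⟩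
  · rw [← Finset.sum_div, div_self hpos.ne']
  · rw [div_mul_eq_mul_div, heq y (Finset.mem_univ y), Finset.sum_div]
    exact Finset.sum_congr rfl fun x _ => by ring

theorem exists_stationary_finset {S : Type*} (q : S → S → ℝ≥0∞) (hq : ∀ x y, q x y ≠ ∞)
    {F : Finset S} (hF : F.Nonempty) : ∃ π : S → ℝ≥0∞, ∑ x ∈ F, π x = 1 ∧
      ∀ y ∈ F, ∑ x ∈ F, π x * q x y = π y * ∑ z ∈ F, q y z := by
  have : Nonempty F := hF.to_subtype
  obtain ⟨v, hv0, hv1, hv⟩ := exists_stationary_fintype (fun x y : F => (q x y).toReal)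
    fun _ _ => ENNReal.toReal_nonneg
  refine ⟨fun x => if h : x ∈ F then ENNReal.ofReal (v ⟨x, h⟩) else 0, ?_, fun y hy => ?_⟩
  · rw [← Finset.sum_coe_sort F]
    simp only [SetLike.coe_mem, dite_true, Subtype.coe_eta]
    rw [← ENNReal.ofReal_sum_of_nonneg fun x _ => hv0 x, hv1, ENNReal.ofReal_one]
  · rw [← Finset.sum_coe_sort F, ← Finset.sum_coe_sort F]
    simp only [SetLike.coe_mem, dite_true, Subtype.coe_eta, hy]
    have h1 : ∀ x z : S, q x z = ENNReal.ofReal (q x z).toReal := fun x z =>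
      (ENNReal.ofReal_toReal (hq x z)).symm
    rw [Finset.sum_congr rfl fun x _ => by
      rw [h1 x.1 y, ← ENNReal.ofReal_mul (hv0 x)],
      Finset.sum_congr (s₁ := Finset.univ) (f := fun z : F => q y z) rfl fun z _ => h1 y z.1]
    rw [← ENNReal.ofReal_sum_of_nonneg fun x _ => mul_nonneg (hv0 x) ENNReal.toReal_nonneg,
      ← ENNReal.ofReal_sum_of_nonneg fun x _ => ENNReal.toReal_nonneg,
      ← ENNReal.ofReal_mul (hv0 _)]
    exact congrArg _ (hv ⟨y, hy⟩)

section Stationary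

variable {S : Type*} {q : S → S → ℝ≥0∞}

/-- The drift condition survives the suppression of all jumps out of a sublevel set. -/
theorem truncated_drift (hq : ∀ x, exitRate q x ≠ ∞) {V : S → ℕ} {d : S → ℝ≥0∞} {b : ℝ≥0∞}
    (hdrift : ∀ x, ∑' z, q x z * V z + d x ≤ exitRate q x * V x + b)
    {F : Finset S} {y : S} (hF : ∀ z ∉ F, V y ≤ V z) :
    ∑ z ∈ F, q y z * V z + d y ≤ (∑ z ∈ F, q y z) * V y + b := by
  have hsplit : ∀ g : S → ℝ≥0∞, ∑' z, g z = ∑ z ∈ F, g z + ∑' z, if z ∈ F then 0 else g z := by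
    intro g
    have h : ∑' z, (if z ∈ F then g z else 0) = ∑ z ∈ F, g z :=
      (tsum_eq_sum fun z hz => if_neg hz).trans (Finset.sum_congr rfl fun z hz => if_pos hz)
    rw [← h, ← ENNReal.tsum_add]
    exact tsum_congr fun z => by split_ifs <;> simp
  -- The suppressed jumps do not lower `V`, so dropping them can only decrease the drift.
  have h1 : (∑' z, if z ∈ F then 0 else q y z) * V y ≤ ∑' z, if z ∈ F then 0 else q y z * V z := by
    rw [← ENNReal.tsum_mul_right]
    refine ENNReal.tsum_le_tsum fun z => ?_
    split_ifs with h
    · simp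
    · gcongr
      exact hF z h
  have h2 : (∑' z, if z ∈ F then 0 else q y z) * V y ≠ ∞ := by
    refine ENNReal.mul_ne_top (ne_top_of_le_ne_top (hq y) (ENNReal.tsum_le_tsum fun z => ?_))
      (ENNReal.natCast_ne_top _)
    split_ifs <;> simp
  have h3 := hdrift y
  rw [exitRate, hsplit, hsplit (fun z => q y z), add_mul] at h3
  refine (ENNReal.add_le_add_iff_left h2).1 (le_trans ?_ (h3.trans (le_of_eq (by ring))))
  calc _ ≤ (∑' z, if z ∈ F then 0 else q y z * V z) + (∑ z ∈ F, q y z * V z + d y) :=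
        add_le_add_left h1 _
    _ = _ := by ring

/-- Averaging the truncated drift over the stationary law cancels the `V` terms, which are finite
sums of finite numbers. The resulting bound `b` does not depend on the level `n`. -/
theorem exists_truncated_stationary (hq : ∀ x, exitRate q x ≠ ∞) {V : S → ℕ} {d : S → ℝ≥0∞}
    {b : ℝ≥0∞} (hdrift : ∀ x, ∑' z, q x z * V z + d x ≤ exitRate q x * V x + b)
    {n : ℕ} {F : Finset S} (hF : ∀ x, x ∈ F ↔ V x ≤ n) (hne : F.Nonempty) :
    ∃ π : S → ℝ≥0∞, ∑ x ∈ F, π x = 1 ∧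
      (∀ y ∈ F, ∑ x ∈ F, π x * q x y = π y * ∑ z ∈ F, q y z) ∧
      ∑ x ∈ F, π x * d x ≤ b := by
  have hq' : ∀ x y, q x y ≠ ∞ := fun x y =>
    ne_top_of_le_ne_top (hq x) (ENNReal.le_tsum y)
  obtain ⟨π, h1, h2⟩ := exists_stationary_finset q hq' hne
  refine ⟨π, h1, h2, ?_⟩
  have h3 : ∀ y ∈ F, π y * (∑ z ∈ F, q y z * V z) + π y * d y ≤
      π y * ((∑ z ∈ F, q y z) * V y) + π y * b := by
    intro y hy
    rw [← mul_add, ← mul_add]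
    refine mul_le_mul_right ?_ _
    refine truncated_drift hq hdrift fun z hz => ?_
    have := (hF y).1 hy
    have := mt (hF z).2 hz
    omega
  have h4 := Finset.sum_le_sum h3
  rw [Finset.sum_add_distrib, Finset.sum_add_distrib, ← Finset.sum_mul, h1, one_mul] at h4
  have h5 : ∑ y ∈ F, π y * (∑ z ∈ F, q y z * V z) = ∑ y ∈ F, π y * ((∑ z ∈ F, q y z) * V y) := by
    calc _ = ∑ y ∈ F, ∑ z ∈ F, π y * q y z * V z := by simp only [Finset.mul_sum, ← mul_assoc]
      _ = ∑ z ∈ F, ∑ y ∈ F, π y * q y z * V z := Finset.sum_comm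
      _ = _ := Finset.sum_congr rfl fun y hy => by rw [← Finset.sum_mul, h2 y hy, mul_assoc]
  rw [h5] at h4
  refine (ENNReal.add_le_add_iff_left ?_).1 h4
  refine ENNReal.sum_ne_top.2 fun y hy => ENNReal.mul_ne_top ?_ (ENNReal.mul_ne_top
    (ENNReal.sum_ne_top.2 fun z _ => hq' y z) (ENNReal.natCast_ne_top _))
  refine ne_top_of_le_ne_top ENNReal.one_ne_top ?_
  rw [← h1]
  exact Finset.single_le_sum (fun _ _ => zero_le) hy

/-- `ℝ≥0∞` is compact, so one ultrafilter gives limits at all states at once, in place of a diagonal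
subsequence. -/
theorem exists_pointwise_limit (π : ℕ → S → ℝ≥0∞) : ∃ (U : Ultrafilter ℕ) (p : S → ℝ≥0∞),
    (U : Filter ℕ) ≤ Filter.atTop ∧ ∀ x, Filter.Tendsto (fun n => π n x) U (nhds (p x)) := by
  refine ⟨Ultrafilter.of Filter.atTop, fun x =>
    ((Ultrafilter.of Filter.atTop).map fun n => π n x).lim, Ultrafilter.of_le _, fun x => ?_⟩
  exact Ultrafilter.le_nhds_lim ((Ultrafilter.of Filter.atTop).map fun n => π n x)

/-- Foster–Lyapunov criterion: existence of a stationary distribution. -/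
theorem exists_stationary [Nonempty S] (hq : ∀ x, exitRate q x ≠ ∞) {V D : S → ℕ}
    (hV : ∀ n, {x | V x ≤ n}.Finite) (hD : ∀ n, {x | D x ≤ n}.Finite) {κ b C : ℝ≥0∞}
    (hκ : κ ≠ 0) (hb : b ≠ ∞) (hC : C ≠ ∞)
    (hdrift : ∀ x, ∑' z, q x z * V z + κ * D x ≤ exitRate q x * V x + b)
    (hgrowth : ∀ x, exitRate q x ≤ D x + C) :
    ∃ π : S → ℝ≥0∞, ∑' x, π x = 1 ∧ (∀ y, ∑' x, π x * q x y = π y * exitRate q y) ∧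
      ∑' x, π x * exitRate q x ≠ ∞ := by
  have hq' : ∀ x y, q x y ≠ ∞ := fun x y =>
    ne_top_of_le_ne_top (hq x) (ENNReal.le_tsum y)
  obtain ⟨x₀⟩ := ‹Nonempty S›
  let F : ℕ → Finset S := fun n => (hV (V x₀ + n)).toFinset
  have hF : ∀ n x, x ∈ F n ↔ V x ≤ V x₀ + n := fun n x => Set.Finite.mem_toFinset _
  choose p hp1 hp2 hp3 using fun n => exists_truncated_stationary hq hdrift (hF n)
    ⟨x₀, (hF n x₀).2 (by omega)⟩
  obtain ⟨U, π, hU, hπ⟩ := exists_pointwise_limit p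
  have hsum : ∀ (G : Finset S) (c : S → ℝ≥0∞), (∀ x, c x ≠ ∞) →
      Filter.Tendsto (fun n => ∑ x ∈ G, p n x * c x) U (nhds (∑ x ∈ G, π x * c x)) :=
    fun G c hc => tendsto_finsetSum _ fun x _ =>
      ENNReal.Tendsto.mul_const (hπ x) (Or.inr (hc x))
  have hsub : ∀ G : Finset S, ∀ᶠ n in (U : Filter ℕ), G ⊆ F n := by
    intro G
    refine hU (Filter.eventually_atTop.2 ⟨G.sup V, fun n hn x hx => (hF n x).2 ?_⟩)
    have := Finset.le_sup (f := V) hx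
    omega
  have hle1 : ∑' x, π x ≤ 1 := by
    rw [ENNReal.tsum_eq_iSup_sum]
    refine iSup_le fun G => ?_
    have h := hsum G (fun _ => 1) fun _ => ENNReal.one_ne_top
    simp only [mul_one] at h
    refine le_of_tendsto h ?_
    filter_upwards [hsub G] with n hn
    rw [← hp1 n]
    exact Finset.sum_le_sum_of_subset hn
  have hκD : ∀ n (G : Finset S), G ⊆ F n → κ * ∑ x ∈ G, p n x * D x ≤ b := by
    intro n G hG
    rw [Finset.mul_sum]
    refine le_trans ?_ (hp3 n)
    refine (Finset.sum_le_sum_of_subset hG).trans_eq (Finset.sum_congr rfl fun x _ => ?_)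
    ring
  have hDle : ∑' x, π x * D x ≤ b / κ := by
    rw [ENNReal.tsum_eq_iSup_sum]
    refine iSup_le fun G => ?_
    refine le_of_tendsto (hsum G (fun x => D x) fun x => ENNReal.natCast_ne_top _) ?_
    filter_upwards [hsub G] with n hn
    rw [ENNReal.le_div_iff_mul_le (Or.inl hκ) (Or.inr hb), mul_comm]
    exact hκD n G hn
  have hbκ : b / κ ≠ ∞ := ENNReal.div_ne_top hb hκ
  have hge1 : 1 ≤ ∑' x, π x := by
    -- Tightness: by Markov's inequality each truncated law gives `{D > N}` mass at most `(b / κ) /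
    -- (N + 1)`, and the complement is finite.
    have key : ∀ N : ℕ, 1 ≤ ∑' x, π x + (b / κ) / (N + 1 : ℕ) := by
      intro N
      let G := (hD N).toFinset
      have h := (hsum G (fun _ => 1) fun _ => ENNReal.one_ne_top).add_const ((b / κ) / (N + 1 : ℕ))
      simp only [mul_one] at h
      refine le_trans (ge_of_tendsto h ?_) (add_le_add_left (ENNReal.sum_le_tsum G) _)
      filter_upwards [hsub G] with n hn
      rw [← hp1 n, ← Finset.sum_sdiff hn, add_comm]
      gcongr
      rw [ENNReal.le_div_iff_mul_le (Or.inl (by simp)) (Or.inl (ENNReal.natCast_ne_top _)),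
        ENNReal.le_div_iff_mul_le (Or.inl hκ) (Or.inr hb), mul_comm]
      refine le_trans ?_ (hκD n (F n \ G) Finset.sdiff_subset)
      gcongr
      rw [Finset.sum_mul]
      refine Finset.sum_le_sum fun x hx => ?_
      gcongr
      have : ¬ D x ≤ N := fun hh => (Finset.mem_sdiff.1 hx).2 ((Set.Finite.mem_toFinset _).2 hh)
      omega
    have hlim : Filter.Tendsto (fun N : ℕ => ∑' x, π x + (b / κ) / (N + 1 : ℕ)) Filter.atTop
        (nhds (∑' x, π x + 0)) := by
      refine Filter.Tendsto.const_add _ ?_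
      exact (Filter.tendsto_add_atTop_iff_nat (f := fun N : ℕ => (b / κ) / (N : ℝ≥0∞)) 1).2
        (ENNReal.Tendsto.const_div ENNReal.tendsto_nat_nhds_top (Or.inr hbκ) |>.trans (by simp))
    rw [add_zero] at hlim
    exact ge_of_tendsto' hlim key
  have hmass : ∑' x, π x = 1 := le_antisymm hle1 hge1
  have hfin : ∑' x, π x * exitRate q x ≠ ∞ := by
    refine ne_top_of_le_ne_top (b := ∑' x, π x * D x + C) ?_ ?_
    · exact ENNReal.add_ne_top.2 ⟨ne_top_of_le_ne_top hbκ hDle, hC⟩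
    · calc _ ≤ ∑' x, (π x * D x + π x * C) := by
            refine ENNReal.tsum_le_tsum fun x => ?_
            rw [← mul_add]
            gcongr
            exact hgrowth x
        _ = _ := by rw [ENNReal.tsum_add, ENNReal.tsum_mul_right, hmass, one_mul]
  -- The limit yields only an inequality, as in Fatou's lemma. Summed over `y`, both sides equal the
  -- finite mean exit rate, which forces equality.
  have hsubinv : ∀ y, ∑' x, π x * q x y ≤ π y * exitRate q y := by
    intro y
    rw [ENNReal.tsum_eq_iSup_sum]
    refine iSup_le fun G => ?_
    refine le_of_tendsto_of_tendsto (hsum G (fun x => q x y) fun x => hq' x y)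
      (ENNReal.Tendsto.mul_const (hπ y) (Or.inr (hq y))) ?_
    filter_upwards [hsub (insert y G)] with n hn
    calc _ ≤ ∑ x ∈ F n, p n x * q x y :=
          Finset.sum_le_sum_of_subset ((Finset.subset_insert _ _).trans hn)
      _ = _ := hp2 n y (hn (Finset.mem_insert_self _ _))
      _ ≤ _ := by gcongr; exact ENNReal.sum_le_tsum _
  refine ⟨π, hmass, fun y => ?_, hfin⟩
  refine le_antisymm (hsubinv y) (not_lt.1 fun hlt => ?_)
  have htot : ∑' y, ∑' x, π x * q x y = ∑' y, π y * exitRate q y := by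
    rw [ENNReal.tsum_comm]
    exact tsum_congr fun x => ENNReal.tsum_mul_left
  exact (ENNReal.tsum_lt_tsum (htot ▸ hfin) hsubinv hlt).ne htot

/-- Under a stationary distribution a function goes up and down at the same mean rate. -/
theorem stationary_balance {π : S → ℝ≥0∞}
    (hπ : ∀ y, ∑' x, π x * q x y = π y * exitRate q y) (hfin : ∑' x, π x * exitRate q x ≠ ∞)
    (V : S → ℕ) :
    ∑' x, π x * ∑' z, q x z * (V z - V x : ℕ) = ∑' x, π x * ∑' z, q x z * (V x - V z : ℕ) := by
  -- `V` need not have finite mean, so it is cut off at `n`. Natural subtraction is the positive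
  -- part of the increment, and the truncated positive parts increase to the full one.
  have hsup : ∀ a b : ℕ, ((a - b : ℕ) : ℝ≥0∞) = ⨆ n : ℕ, ((min a n - min b n : ℕ) : ℝ≥0∞) := by
    intro a b
    refine le_antisymm ?_ (iSup_le fun n => Nat.cast_le.2 (by omega))
    refine le_iSup_of_le (max a b) (Nat.cast_le.2 (by omega))
  have hmono : ∀ a b : ℕ, Monotone fun n : ℕ => ((min a n - min b n : ℕ) : ℝ≥0∞) := by
    intro a b m n h
    exact Nat.cast_le.2 (by omega)
  have hlim : ∀ A B : S → S → ℕ, ∑' x, π x * ∑' z, q x z * (A x z - B x z : ℕ) =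
      ⨆ n : ℕ, ∑' x, π x * ∑' z, q x z * (min (A x z) n - min (B x z) n : ℕ) := by
    intro A B
    have h1 : ∀ x z, Monotone fun n : ℕ => q x z * (min (A x z) n - min (B x z) n : ℕ) :=
      fun x z m n h => mul_le_mul_right (hmono _ _ h) _
    have h2 : ∀ x, Monotone fun n : ℕ =>
        π x * ∑' z, q x z * (min (A x z) n - min (B x z) n : ℕ) :=
      fun x m n h => mul_le_mul_right (ENNReal.tsum_le_tsum fun z => h1 x z h) _
    rw [← tsum_iSup_of_monotone h2]
    refine tsum_congr fun x => ?_
    rw [← ENNReal.mul_iSup, ← tsum_iSup_of_monotone (h1 x)]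
    congr 1
    refine tsum_congr fun z => ?_
    rw [hsup, ENNReal.mul_iSup]
  rw [hlim (fun _ z => V z) fun x _ => V x, hlim (fun x _ => V x) fun _ z => V z]
  congr 1
  ext1 n
  let φ : S → ℕ := fun x => min (V x) n
  change ∑' x, π x * ∑' z, q x z * (φ z - φ x : ℕ) = ∑' x, π x * ∑' z, q x z * (φ x - φ z : ℕ)
  have hout : ∑' x, π x * ∑' z, q x z * (φ x : ℝ≥0∞) = ∑' x, π x * exitRate q x * φ x := by
    refine tsum_congr fun x => ?_
    rw [ENNReal.tsum_mul_right, mul_assoc]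
    rfl
  have hin : ∑' x, π x * ∑' z, q x z * (φ z : ℝ≥0∞) = ∑' x, π x * exitRate q x * φ x := by
    simp only [← ENNReal.tsum_mul_left, ← mul_assoc]
    rw [ENNReal.tsum_comm]
    simp only [ENNReal.tsum_mul_right, hπ]
  have hne : ∑' x, π x * exitRate q x * φ x ≠ ∞ := by
    refine ne_top_of_le_ne_top (ENNReal.mul_ne_top hfin (ENNReal.natCast_ne_top n)) ?_
    rw [← ENNReal.tsum_mul_right]
    refine ENNReal.tsum_le_tsum fun x => ?_
    gcongr
    exact min_le_right _ _
  -- One finite quantity is added to both sides, in its two forms `hout` and `hin`; then each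
  -- summand equals the maximum of `φ x` and `φ z`.
  refine (ENNReal.add_right_inj hne).1 ?_
  nth_rewrite 1 [← hout]
  rw [← hin]
  simp only [← ENNReal.tsum_add, ← mul_add]
  refine tsum_congr fun x => ?_
  congr 2
  ext1 z
  congr 1
  norm_cast
  omega

/-- A stationary distribution of the jump rates with finite mean exit rate is invariant under the
evolution given by the integrated backward equation. -/
theorem stationary_invariant [Countable S] {π : S → ℝ≥0∞}
    (hπ : ∀ y, ∑' x, π x * q x y = π y * exitRate q y) (hfin : ∑' x, π x * exitRate q x ≠ ∞)
    {f : S → ℝ≥0∞} {w : ℝ → S → ℝ≥0∞} (hw : ∀ x, Measurable fun t => w t x)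
    (hw1 : ∀ t, 0 ≤ t → ∀ x, w t x ≤ 1) {t : ℝ}
    (hint : ∀ x, w t x + ∫⁻ s in Set.Icc 0 t, exitRate q x * w s x =
      f x + ∫⁻ s in Set.Icc 0 t, ∑' z, q x z * w s z) :
    ∑' x, π x * w t x = ∑' x, π x * f x := by
  have h1 : ∑' x, π x * ∫⁻ s in Set.Icc 0 t, exitRate q x * w s x =
      ∑' x, π x * ∫⁻ s in Set.Icc 0 t, ∑' z, q x z * w s z := by
    have e1 : ∀ x, π x * ∫⁻ s in Set.Icc 0 t, exitRate q x * w s x =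
        ∫⁻ s in Set.Icc 0 t, π x * exitRate q x * w s x := by
      intro x
      rw [← lintegral_const_mul _ (by fun_prop)]
      simp only [mul_assoc]
    have e2 : ∀ x, π x * ∫⁻ s in Set.Icc 0 t, ∑' z, q x z * w s z =
        ∫⁻ s in Set.Icc 0 t, ∑' z, π x * q x z * w s z := by
      intro x
      rw [← lintegral_const_mul _ (by fun_prop)]
      simp only [mul_assoc, ENNReal.tsum_mul_left]
    simp only [e1, e2]
    rw [← lintegral_tsum (fun x => by fun_prop), ← lintegral_tsum (fun x => by fun_prop)]
    refine lintegral_congr fun s => ?_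
    rw [ENNReal.tsum_comm]
    simp only [ENNReal.tsum_mul_right, hπ]
  -- Finiteness of the mean exit rate is what allows the two integral terms to be cancelled.
  have h2 : ∑' x, π x * ∫⁻ s in Set.Icc 0 t, exitRate q x * w s x ≠ ∞ := by
    refine ne_top_of_le_ne_top (ENNReal.mul_ne_top hfin (ENNReal.ofReal_ne_top (r := t))) ?_
    rw [← ENNReal.tsum_mul_right]
    refine ENNReal.tsum_le_tsum fun x => ?_
    rw [mul_assoc]
    gcongr
    calc _ ≤ ∫⁻ s in Set.Icc 0 t, exitRate q x :=
          setLIntegral_mono' measurableSet_Icc fun s hs => mul_le_of_le_one_right' (hw1 s hs.1 x)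
      _ = _ := by simp
  refine (ENNReal.add_left_inj h2).1 ?_
  nth_rewrite 2 [h1]
  simp only [← ENNReal.tsum_add, ← mul_add, hint]

/-- Two invariant distributions of a family of transition matrices agree if there is a state that
can be reached from everywhere. -/
theorem invariant_unique {ι : Type*} {P : ι → S → S → ℝ≥0∞} (hP : ∀ i x, ∑' y, P i x y = 1)
    {o : S} (ho : ∀ x, ∃ i, P i x o ≠ 0) {μ ν : S → ℝ≥0∞} (hμ1 : ∑' x, μ x = 1)
    (hν1 : ∑' x, ν x = 1) (hμ : ∀ i y, ∑' x, μ x * P i x y = μ y)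
    (hν : ∀ i y, ∑' x, ν x * P i x y = ν y) : μ = ν := by
  let m : S → ℝ≥0∞ := fun x => min (μ x) (ν x)
  have hmfin : ∑' x, m x ≠ ∞ :=
    ne_top_of_le_ne_top ENNReal.one_ne_top
      (hμ1 ▸ ENNReal.tsum_le_tsum fun x => min_le_left _ _)
  have hmle : ∀ i y, ∑' x, m x * P i x y ≤ m y := by
    intro i y
    refine le_min ?_ ?_
    · rw [← hμ i y]
      gcongr
      exact min_le_left _ _
    · rw [← hν i y]
      gcongr
      exact min_le_right _ _
  -- The matrices preserve total mass, so a subinvariant `m` of finite mass is invariant.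
  have hm : ∀ i y, ∑' x, m x * P i x y = m y := by
    intro i y
    refine le_antisymm (hmle i y) (not_lt.1 fun hlt => ?_)
    have htot : ∑' y, ∑' x, m x * P i x y = ∑' y, m y := by
      rw [ENNReal.tsum_comm]
      exact tsum_congr fun x => by rw [ENNReal.tsum_mul_left, hP, mul_one]
    exact (ENNReal.tsum_lt_tsum (htot ▸ hmfin) (hmle i) hlt).ne htot
  have hmx : ∀ x, m x ≠ ∞ := fun x => ne_top_of_le_ne_top hmfin (ENNReal.le_tsum x)
  -- An excess of `ρ` over `m` at any state would be carried to `o` by some `P i`, contradicting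
  -- equality there.
  have key : ∀ {ρ : S → ℝ≥0∞}, (∀ i y, ∑' x, ρ x * P i x y = ρ y) → (∀ x, m x ≤ ρ x) →
      ρ o = m o → ρ = m := by
    intro ρ hρ hle ho'
    by_contra hne
    obtain ⟨x, hx⟩ := Function.ne_iff.1 hne
    obtain ⟨i, hi⟩ := ho x
    have h1 : ∑' x, m x * P i x o < ∑' x, ρ x * P i x o := by
      have hPx : P i x o ≠ ∞ := ne_top_of_le_ne_top ENNReal.one_ne_top
        (hP i x ▸ ENNReal.le_tsum o)
      refine ENNReal.tsum_lt_tsum (i := x) (by rw [hm]; exact hmx o)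
        (fun x => mul_le_mul_left (hle x) _) ?_
      exact ENNReal.mul_lt_mul_left hi hPx (lt_of_le_of_ne (hle x) (Ne.symm hx))
    rw [hm, hρ, ho'] at h1
    exact lt_irrefl _ h1
  have hclose : ∀ {ρ σ : S → ℝ≥0∞}, ∑' x, ρ x = 1 → ∑' x, σ x = 1 → (∀ x, ρ x ≤ σ x) → ρ = σ := by
    intro ρ σ h1 h2 hle
    by_contra hne
    obtain ⟨x, hx⟩ := Function.ne_iff.1 hne
    have := ENNReal.tsum_lt_tsum (by rw [h1]; exact ENNReal.one_ne_top) hle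
      (lt_of_le_of_ne (hle x) hx)
    rw [h1, h2] at this
    exact lt_irrefl _ this
  rcases le_total (μ o) (ν o) with h | h
  · have := key hμ (fun x => min_le_left _ _) (min_eq_left h).symm
    exact hclose hμ1 hν1 fun x => by rw [this]; exact min_le_right _ _
  · have := key hν (fun x => min_le_right _ _) (min_eq_right h).symm
    exact (hclose hν1 hμ1 fun x => by rw [this]; exact min_le_left _ _).symm

theorem transitionMean_ne_zero_of_ne_zero {f : S → ℝ≥0∞} [Countable S] {x : S} (hx : f x ≠ 0)
    (t : ℝ) : transitionMean q f t x ≠ 0 := by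
  rw [transitionMean_mild]
  simp [hx, Real.exp_pos]

/-- A jump to `z` at any time `s < t` leaves positive time `t - s`, and such `s` have positive
measure. -/
theorem transitionMean_ne_zero_of_jump [Countable S] {f : S → ℝ≥0∞} {x z : S} (hxz : q x z ≠ 0)
    (hz : ∀ t, 0 < t → transitionMean q f t z ≠ 0) {t : ℝ} (ht : 0 < t) :
    transitionMean q f t x ≠ 0 := by
  rw [transitionMean_mild]
  refine fun h => absurd (add_eq_zero.1 h).2 (ne_of_gt ?_)
  have hm := measurable_transitionMean q f
  rw [setLIntegral_pos_iff (by fun_prop)]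
  refine lt_of_lt_of_le (b := volume (Set.Ico 0 t)) (by simpa using ht) (measure_mono ?_)
  intro s hs
  refine ⟨mul_ne_zero (by simp [Real.exp_pos]) ?_, hs.1, hs.2.le⟩
  rw [Ne, ENNReal.tsum_eq_zero]
  exact fun h => mul_ne_zero hxz (hz (t - s) (sub_pos.2 hs.2)) (h z)

end Stationary

/-! ### Combinatorics of configurations -/

theorem Config.ext' {η ζ : Config} (h : ∀ x, x ∈ η.1 ↔ x ∈ ζ.1) : η = ζ :=
  Subtype.ext (Set.ext h)

instance : Countable Config := by
  refine Function.Injective.countable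
    (f := fun η : Config => (η.2.1.toFinset, η.2.2.toFinset)) fun η ζ h => ?_
  simp only [Prod.mk.injEq, Set.Finite.toFinset_inj, Set.ext_iff, Set.mem_ofPred_eq] at h
  refine Config.ext' fun x => ?_
  have h1 := h.1 x
  have h2 := h.2 x
  rcases le_total 0 x with hx | hx
  · tauto
  · tauto

instance : Countable CenteredConfig := Subtype.countable

theorem isGreatest_rightmost (η : Config) : IsGreatest η.1 (rightmost η) := by
  have hne : η.1.Nonempty := by
    by_contra h
    rw [Set.not_nonempty_iff_eq_empty] at h
    refine Set.infinite_of_not_bddBelow (s := {x : ℤ | x ≤ 0 ∧ x ∉ η.1}) ?_ η.2.2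
    rintro ⟨b, hb⟩
    have := hb (a := min b 0 - 1) ⟨by omega, by simp [h]⟩
    omega
  have hbdd : BddAbove η.1 := by
    obtain ⟨b, hb⟩ := η.2.1.bddAbove
    refine ⟨max b 0, fun x hx => ?_⟩
    by_cases h : 0 ≤ x
    · exact (hb ⟨h, hx⟩).trans (le_max_left _ _)
    · exact (not_le.1 h).le.trans (le_max_right _ _)
  exact ⟨Int.csSup_mem hne hbdd, fun x hx => le_csSup hbdd hx⟩

theorem isLeast_leftmost (η : Config) : IsLeast (η.1)ᶜ (leftmost η) := by
  have hne : (η.1)ᶜ.Nonempty := by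
    refine ⟨rightmost η + 1, fun h => ?_⟩
    have := (isGreatest_rightmost η).2 h
    omega
  have hbdd : BddBelow (η.1)ᶜ := by
    obtain ⟨b, hb⟩ := η.2.2.bddBelow
    refine ⟨min b 0, fun x hx => ?_⟩
    by_cases h : x ≤ 0
    · exact (min_le_left _ _).trans (hb ⟨h, hx⟩)
    · exact (min_le_right _ _).trans (not_le.1 h).le
  exact ⟨Int.csInf_mem hne hbdd, fun x hx => csInf_le hbdd hx⟩

theorem rightmost_mem (η : Config) : rightmost η ∈ η.1 := (isGreatest_rightmost η).1

theorem le_rightmost {η : Config} {x : ℤ} (h : x ∈ η.1) : x ≤ rightmost η :=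
  (isGreatest_rightmost η).2 h

theorem leftmost_notMem (η : Config) : leftmost η ∉ η.1 := (isLeast_leftmost η).1

theorem leftmost_le {η : Config} {x : ℤ} (h : x ∉ η.1) : leftmost η ≤ x :=
  (isLeast_leftmost η).2 h

theorem leftmost_le_rightmost_add_one (η : Config) : leftmost η ≤ rightmost η + 1 :=
  leftmost_le fun h => by have := le_rightmost h; omega

theorem mem_exchange {η : Config} {x y : ℤ} :
    y ∈ (exchange η x).1 ↔ Equiv.swap x (x + 1) y ∈ η.1 := Iff.rfl

theorem mem_death {η : Config} {y : ℤ} : y ∈ (death η).1 ↔ y ∈ η.1 ∧ y ≠ rightmost η := Iff.rfl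

theorem mem_birth {η : Config} {y : ℤ} : y ∈ (birth η).1 ↔ y ∈ η.1 ∨ y = leftmost η := Iff.rfl

theorem mem_translate {η : Config} {x y : ℤ} : x ∈ (translate y η).1 ↔ x + y ∈ η.1 := Iff.rfl

theorem death_ne (η : Config) : death η ≠ η := fun h =>
  (mem_death.1 (h.symm ▸ rightmost_mem η : rightmost η ∈ (death η).1)).2 rfl

theorem birth_ne (η : Config) : birth η ≠ η := fun h =>
  by
  have h1 : leftmost η ∈ (birth η).1 := mem_birth.2 (Or.inr rfl)
  rw [h] at h1
  exact leftmost_notMem η h1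

theorem exchange_exchange (η : Config) (x : ℤ) : exchange (exchange η x) x = η :=
  Config.ext' fun y => by rw [mem_exchange, mem_exchange, Equiv.swap_apply_self]

theorem exchange_eq_self_iff {η : Config} {x : ℤ} :
    exchange η x = η ↔ (x ∈ η.1 ↔ x + 1 ∈ η.1) := by
  constructor
  · intro h
    have h1 : x ∈ (exchange η x).1 ↔ x ∈ η.1 := by rw [h]
    rw [mem_exchange, Equiv.swap_apply_left] at h1
    exact h1.symm
  · intro h
    refine Config.ext' fun y => ?_
    rw [mem_exchange, Equiv.swap_apply_def]
    split_ifs with h1 h2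
    · rw [h1]; exact h.symm
    · rw [h2]; exact h
    · rfl

/-! ### The area and its change under the moves. -/

/-- Pairs of a hole and a particle to its right. -/
def inversions (η : Config) : Set (ℤ × ℤ) := {p | p.1 < p.2 ∧ p.1 ∉ η.1 ∧ p.2 ∈ η.1}

theorem finite_inversions (η : Config) : (inversions η).Finite := by
  refine ((Set.finite_Icc (leftmost η) (rightmost η)).prod
    (Set.finite_Icc (leftmost η) (rightmost η))).subset ?_
  rintro ⟨a, b⟩ ⟨h1, h2, h3⟩
  have := leftmost_le h2
  have := le_rightmost h3
  simp only at *
  exact ⟨⟨by simp only; omega, by simp only; omega⟩, by simp only; omega, by simp only; omega⟩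

/-- The number of inversions: the size of the partition whose boundary is the configuration. -/
noncomputable def area (η : Config) : ℕ := (inversions η).ncard

/-- Sites from which a particle can jump to the right. -/
def upSites (η : Config) : Set ℤ := {x | x ∈ η.1 ∧ x + 1 ∉ η.1}

/-- Sites to which a particle can jump from the right. -/
def downSites (η : Config) : Set ℤ := {x | x ∉ η.1 ∧ x + 1 ∈ η.1}

/-- Holes to the left of the rightmost particle. -/
def innerHoles (η : Config) : Set ℤ := {x | x < rightmost η ∧ x ∉ η.1}

/-- Particles to the right of the leftmost hole. -/
def innerParticles (η : Config) : Set ℤ := {x | leftmost η < x ∧ x ∈ η.1}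

/-- The number of sites from the leftmost hole to the rightmost particle. -/
noncomputable def width (η : Config) : ℕ := (rightmost η - leftmost η + 1).toNat

theorem width_eq (η : Config) : (width η : ℤ) = rightmost η - leftmost η + 1 :=
  Int.toNat_of_nonneg (by have := leftmost_le_rightmost_add_one η; omega)

theorem width_eq_ncard (η : Config) : width η = (Set.Icc (leftmost η) (rightmost η)).ncard := by
  rw [← Finset.coe_Icc, Set.ncard_coe_finset, Int.card_Icc, width]
  congr 1
  ring

/-- Swapping adjacent sites preserves the order of every pair other than `x, x + 1` itself, so
inversions are carried to inversions and only that pair is new. -/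
theorem area_exchange_of_up {η : Config} {x : ℤ} (h1 : x ∈ η.1) (h2 : x + 1 ∉ η.1) :
    area (exchange η x) = area η + 1 := by
  let σ := (Equiv.swap x (x + 1)).prodCongr (Equiv.swap x (x + 1))
  have h : inversions (exchange η x) = insert (x, x + 1) (σ '' inversions η) := by
    rw [Equiv.image_eq_preimage_symm]
    ext ⟨a, b⟩
    have hl : Equiv.swap x (x + 1) x = x + 1 := Equiv.swap_apply_left _ _
    have hr : Equiv.swap x (x + 1) (x + 1) = x := Equiv.swap_apply_right _ _
    have hne : ∀ c, c ≠ x → c ≠ x + 1 → Equiv.swap x (x + 1) c = c := fun c =>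
      Equiv.swap_apply_of_ne_of_ne
    change (a < b ∧ Equiv.swap x (x + 1) a ∉ η.1 ∧ Equiv.swap x (x + 1) b ∈ η.1) ↔
      (a, b) = (x, x + 1) ∨ (Equiv.swap x (x + 1) a < Equiv.swap x (x + 1) b ∧
        Equiv.swap x (x + 1) a ∉ η.1 ∧ Equiv.swap x (x + 1) b ∈ η.1)
    rw [Prod.mk.injEq]
    by_cases ha : a = x
    · subst ha
      by_cases hb : b = a + 1
      · subst hb
        simp [h1, h2]
      · by_cases hb' : b = a
        · subst hb'
          simp
        · rw [hl, hne b hb' hb]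
          have : a < b ↔ a + 1 < b := by omega
          simp [hb, this]
    · by_cases ha' : a = x + 1
      · subst ha'
        simp [hr, h1]
      · rw [hne a ha ha']
        simp only [ha, false_and, false_or]
        by_cases hb : b = x
        · subst hb
          simp [hl, h2]
        · by_cases hb' : b = x + 1
          · subst hb'
            have : a < x + 1 ↔ a < x := by omega
            rw [hr, this]
          · rw [hne b hb hb']
  have hnot : (x, x + 1) ∉ σ '' inversions η := by
    rintro ⟨p, hp, he⟩
    have e1 : Equiv.swap x (x + 1) p.1 = x := congrArg Prod.fst he
    have e2 : p.1 = x + 1 := by rw [Equiv.swap_apply_eq_iff] at e1; simpa using e1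
    have e3 : Equiv.swap x (x + 1) p.2 = x + 1 := congrArg Prod.snd he
    have e4 : p.2 = x := by rw [Equiv.swap_apply_eq_iff] at e3; simpa using e3
    have := hp.1
    omega
  rw [area, h, Set.ncard_insert_of_notMem hnot ((finite_inversions η).image _),
    Set.ncard_image_of_injective _ σ.injective, area]

theorem area_exchange_of_down {η : Config} {x : ℤ} (h1 : x ∉ η.1) (h2 : x + 1 ∈ η.1) :
    area (exchange η x) + 1 = area η := by
  have h := area_exchange_of_up (η := exchange η x) (x := x)
    (by rwa [mem_exchange, Equiv.swap_apply_left])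
    (by rwa [mem_exchange, Equiv.swap_apply_right])
  rw [exchange_exchange] at h
  exact h.symm

/-- The pairs lost are those whose particle is the rightmost one; the new hole has no particle to
its right and creates none. -/
theorem area_death (η : Config) : area (death η) + (innerHoles η).ncard = area η := by
  have hinj : Function.Injective fun x : ℤ => (x, rightmost η) := fun a b h => congrArg Prod.fst h
  have h : inversions η = inversions (death η) ∪ (fun x => (x, rightmost η)) '' innerHoles η := by
    ext ⟨a, b⟩
    simp only [inversions, innerHoles, mem_death, Set.mem_union, Set.mem_image, Set.mem_ofPred_eq,
      Prod.mk.injEq]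
    constructor
    · rintro ⟨h1, h2, h3⟩
      by_cases hb : b = rightmost η
      · exact Or.inr ⟨a, ⟨hb ▸ h1, h2⟩, rfl, hb.symm⟩
      · exact Or.inl ⟨h1, fun h => h2 h.1, h3, hb⟩
    · rintro (⟨h1, h2, h3, h4⟩ | ⟨x, ⟨h1, h2⟩, rfl, rfl⟩)
      · refine ⟨h1, fun ha => h2 ⟨ha, fun h => ?_⟩, h3⟩
        have := le_rightmost h3
        omega
      · exact ⟨h1, h2, rightmost_mem η⟩
  have hdisj : Disjoint (inversions (death η)) ((fun x => (x, rightmost η)) '' innerHoles η) := by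
    rw [Set.disjoint_left]
    rintro _ h1 ⟨x, -, rfl⟩
    exact (mem_death.1 h1.2.2).2 rfl
  rw [area, area, h, Set.ncard_union_eq hdisj (finite_inversions _)
    ((finite_inversions η).subset (h ▸ Set.subset_union_right)),
    Set.ncard_image_of_injective _ hinj]

theorem area_birth (η : Config) : area (birth η) + (innerParticles η).ncard = area η := by
  have hinj : Function.Injective fun x : ℤ => (leftmost η, x) := fun a b h => congrArg Prod.snd h
  have h : inversions η =
      inversions (birth η) ∪ (fun x => (leftmost η, x)) '' innerParticles η := by
    ext ⟨a, b⟩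
    simp only [inversions, innerParticles, mem_birth, Set.mem_union, Set.mem_image,
      Set.mem_ofPred_eq, Prod.mk.injEq]
    constructor
    · rintro ⟨h1, h2, h3⟩
      by_cases ha : a = leftmost η
      · exact Or.inr ⟨b, ⟨ha ▸ h1, h3⟩, ha.symm, rfl⟩
      · exact Or.inl ⟨h1, fun h => h.elim h2 ha, Or.inl h3⟩
    · rintro (⟨h1, h2, h3⟩ | ⟨x, ⟨h1, h2⟩, rfl, rfl⟩)
      · refine ⟨h1, fun ha => h2 (Or.inl ha), h3.resolve_right fun h => ?_⟩
        have := leftmost_le fun ha => h2 (Or.inl ha)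
        omega
      · exact ⟨h1, leftmost_notMem η, h2⟩
  have hdisj : Disjoint (inversions (birth η))
      ((fun x => (leftmost η, x)) '' innerParticles η) := by
    rw [Set.disjoint_left]
    rintro _ h1 ⟨x, -, rfl⟩
    exact h1.2.1 (mem_birth.2 (Or.inr rfl))
  rw [area, area, h, Set.ncard_union_eq hdisj (finite_inversions _)
    ((finite_inversions η).subset (h ▸ Set.subset_union_right)),
    Set.ncard_image_of_injective _ hinj]

/-- The strict inequalities lose no site: the rightmost particle is not a hole and the leftmost hole
not a particle. At area zero the interval is empty. -/
theorem ncard_inner (η : Config) : (innerHoles η).ncard + (innerParticles η).ncard = width η := by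
  have h : innerHoles η ∪ innerParticles η = Set.Icc (leftmost η) (rightmost η) := by
    ext x
    simp only [innerHoles, innerParticles, Set.mem_union, Set.mem_ofPred_eq, Set.mem_Icc]
    constructor
    · rintro (⟨h1, h2⟩ | ⟨h1, h2⟩)
      · exact ⟨leftmost_le h2, h1.le⟩
      · exact ⟨h1.le, le_rightmost h2⟩
    · rintro ⟨h1, h2⟩
      by_cases hx : x ∈ η.1
      · exact Or.inr ⟨lt_of_le_of_ne h1 fun h => leftmost_notMem η (h ▸ hx), hx⟩
      · exact Or.inl ⟨lt_of_le_of_ne h2 fun h => hx (h ▸ rightmost_mem η), hx⟩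
  have hfin := Set.finite_Icc (leftmost η) (rightmost η)
  rw [width_eq_ncard, ← h, Set.ncard_union_eq (Set.disjoint_left.2 fun x h1 h2 => h1.2 h2.2)
    (hfin.subset (h ▸ Set.subset_union_left)) (hfin.subset (h ▸ Set.subset_union_right))]

theorem width_le (η : Config) : width η ≤ 2 * area η := by
  have h1 := area_death η
  have h2 := area_birth η
  have h3 := ncard_inner η
  omega

theorem ncard_downSites_le_width (η : Config) : (downSites η).ncard ≤ width η := by
  rw [width_eq_ncard]
  refine Set.ncard_le_ncard (fun x hx => ⟨leftmost_le hx.1, ?_⟩) (Set.finite_Icc _ _)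
  have := le_rightmost hx.2
  omega

theorem ncard_downSites_le_area (η : Config) : (downSites η).ncard ≤ area η :=
  Set.ncard_le_ncard_of_injOn (fun x => (x, x + 1))
    (fun x hx => ⟨lt_add_one x, hx.1, hx.2⟩) (fun _ _ _ _ h => congrArg Prod.fst h)
    (finite_inversions η)

theorem ncard_eq_sum_range {A : Set ℤ} {a : ℤ} {n : ℕ} (h : ∀ x ∈ A, a ≤ x ∧ x < a + n) :
    (A.ncard : ℤ) = ∑ i ∈ Finset.range n, if a + i ∈ A then 1 else 0 := by
  have h1 : A = (fun i : ℕ => a + i) '' ((Finset.range n).filter fun i => a + i ∈ A : Finset ℕ) := by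
    ext x
    simp only [Set.mem_image, Finset.coe_filter, Finset.mem_range, Set.mem_ofPred_eq]
    constructor
    · intro hx
      have := h x hx
      refine ⟨(x - a).toNat, ⟨by omega, ?_⟩, by omega⟩
      rwa [Int.toNat_of_nonneg (by omega), add_sub_cancel]
    · rintro ⟨i, ⟨-, hi⟩, rfl⟩
      exact hi
  have hinj : Function.Injective fun i : ℕ => a + (i : ℤ) := fun i j h => by simpa using h
  rw [Finset.sum_boole]
  conv_lhs => rw [h1]
  rw [Set.ncard_image_of_injective _ hinj, Set.ncard_coe_finset]

theorem upSites_subset {η : Config} : upSites η ⊆ Set.Icc (leftmost η - 1) (rightmost η) := by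
  intro x hx
  refine ⟨?_, le_rightmost hx.1⟩
  have := leftmost_le hx.2
  omega

theorem downSites_subset {η : Config} : downSites η ⊆ Set.Icc (leftmost η - 1) (rightmost η) := by
  intro x hx
  have := leftmost_le hx.1
  have := le_rightmost hx.2
  exact ⟨by omega, by omega⟩

theorem ncard_upSites (η : Config) : (upSites η).ncard = (downSites η).ncard + 1 := by
  have hLR := leftmost_le_rightmost_add_one η
  -- The window runs from the occupied site `leftmost η - 1` to the empty site `rightmost η + 1`; up
  -- minus down sites telescopes to the difference `1` of the end values.
  obtain ⟨n, hn⟩ : ∃ n : ℕ, (n : ℤ) = rightmost η - leftmost η + 2 :=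
    ⟨_, Int.toNat_of_nonneg (by omega)⟩
  let a : ℕ → ℤ := fun i => if leftmost η - 1 + (i : ℤ) ∈ η.1 then 1 else 0
  have h1 : ((upSites η).ncard : ℤ) - (downSites η).ncard =
      ∑ i ∈ Finset.range n, (a i - a (i + 1)) := by
    rw [ncard_eq_sum_range (a := leftmost η - 1) (n := n) fun x hx => by
        have := upSites_subset hx; rw [Set.mem_Icc] at this; omega,
      ncard_eq_sum_range (A := downSites η) (a := leftmost η - 1) (n := n) fun x hx => by
        have := downSites_subset hx; rw [Set.mem_Icc] at this; omega,
      ← Finset.sum_sub_distrib]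
    refine Finset.sum_congr rfl fun i _ => ?_
    simp only [a, upSites, downSites, Set.mem_ofPred_eq, Nat.cast_add, Nat.cast_one, ← add_assoc]
    by_cases h2 : leftmost η - 1 + (i : ℤ) ∈ η.1 <;>
      by_cases h3 : leftmost η - 1 + (i : ℤ) + 1 ∈ η.1 <;> simp [h2, h3]
  rw [Finset.sum_range_sub'] at h1
  have h2 : a 0 = 1 := by
    refine if_pos (by_contra fun h => ?_)
    have := leftmost_le h
    simp at this
  have h3 : a n = 0 := by
    refine if_neg fun h => ?_
    have := le_rightmost h
    omega
  rw [h2, h3] at h1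
  omega

/-! ### Translations -/

theorem rightmost_translate (y : ℤ) (η : Config) :
    rightmost (translate y η) = rightmost η - y := by
  refine (isGreatest_rightmost _).unique ⟨?_, fun x hx => ?_⟩
  · rw [mem_translate, sub_add_cancel]
    exact rightmost_mem η
  · have := le_rightmost (mem_translate.1 hx)
    omega

theorem leftmost_translate (y : ℤ) (η : Config) :
    leftmost (translate y η) = leftmost η - y := by
  refine (isLeast_leftmost _).unique ⟨?_, fun x hx => ?_⟩
  · rw [Set.mem_compl_iff, mem_translate, sub_add_cancel]
    exact leftmost_notMem η
  · have := leftmost_le (mt mem_translate.2 hx)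
    omega

theorem exchange_translate (y : ℤ) (η : Config) (x : ℤ) :
    exchange (translate y η) x = translate y (exchange η (x + y)) := by
  refine Config.ext' fun z => ?_
  rw [mem_exchange, mem_translate, mem_translate, mem_exchange, add_right_comm x y 1]
  have : Equiv.swap x (x + 1) z + y = Equiv.swap (x + y) (x + 1 + y) (z + y) := by
    simp only [Equiv.swap_apply_def, add_left_inj]
    split_ifs <;> rfl
  rw [this]

theorem death_translate (y : ℤ) (η : Config) : death (translate y η) = translate y (death η) := by
  refine Config.ext' fun z => ?_
  rw [mem_death, mem_translate, mem_translate, mem_death, rightmost_translate]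
  simp only [ne_eq, eq_sub_iff_add_eq]

theorem birth_translate (y : ℤ) (η : Config) : birth (translate y η) = translate y (birth η) := by
  refine Config.ext' fun z => ?_
  rw [mem_birth, mem_translate, mem_translate, mem_birth, leftmost_translate]
  simp only [eq_sub_iff_add_eq]

theorem translate_translate (y z : ℤ) (η : Config) :
    translate y (translate z η) = translate (y + z) η :=
  Config.ext' fun x => by rw [mem_translate, mem_translate, mem_translate, add_assoc]

theorem translate_zero (η : Config) : translate 0 η = η :=
  Config.ext' fun x => by rw [mem_translate, add_zero]

theorem translate_injective (y : ℤ) : Function.Injective (translate y) := fun η ζ h => by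
  have := congrArg (translate (-y)) h
  rwa [translate_translate, translate_translate, neg_add_cancel, translate_zero,
    translate_zero] at this

theorem area_translate (y : ℤ) (η : Config) : area (translate y η) = area η := by
  let e := (Equiv.addRight y).prodCongr (Equiv.addRight y)
  have h : e '' inversions (translate y η) = inversions η := by
    rw [Equiv.image_eq_preimage_symm]
    ext ⟨a, b⟩
    simp [e, inversions, mem_translate]
  rw [area, area, ← h, Set.ncard_image_of_injective _ e.injective]

theorem medianFloor_translate (y : ℤ) (η : Config) :
    medianFloor (translate y η) = medianFloor η - y := by
  rw [medianFloor_eq_iff, excess_translate, sub_add_cancel, ← medianFloor_eq_iff]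

theorem seenFromMedian_translate (y : ℤ) (η : Config) :
    seenFromMedian (translate y η) = seenFromMedian η := by
  refine Subtype.ext ?_
  change translate (medianFloor (translate y η)) (translate y η) = translate (medianFloor η) η
  rw [medianFloor_translate, translate_translate, sub_add_cancel]

theorem medianFloor_centered (x : CenteredConfig) : medianFloor x.1 = 0 := by
  have h := x.2
  rw [median, add_eq_right] at h
  exact_mod_cast h

theorem seenFromMedian_centered (x : CenteredConfig) : seenFromMedian x.1 = x := by
  refine Subtype.ext ?_
  change translate (medianFloor x.1) x.1 = x.1
  rw [medianFloor_centered, translate_zero]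

/-! ### Centred configurations. -/

theorem excess_centered (x : CenteredConfig) :
    {y : ℤ | 0 < y ∧ y ∈ x.1.1}.ncard = {y : ℤ | y ≤ 0 ∧ y ∉ x.1.1}.ncard := by
  have h := (medianFloor_eq_iff x.1 0).1 (medianFloor_centered x)
  rw [excess] at h
  omega

theorem leftmost_centered_le (x : CenteredConfig) : leftmost x.1 ≤ 1 := by
  by_contra h
  have h1 : {y : ℤ | y ≤ 0 ∧ y ∉ x.1.1} = ∅ := by
    refine Set.eq_empty_of_forall_notMem fun y hy => ?_
    have := leftmost_le hy.2
    have := hy.1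
    omega
  have h2 := excess_centered x
  rw [h1, Set.ncard_empty, Set.ncard_eq_zero (x.1.finite_particles 0)] at h2
  refine Set.notMem_empty (1 : ℤ) (h2 ▸ ⟨one_pos, by_contra fun h3 => h (leftmost_le h3)⟩)

theorem le_rightmost_centered (x : CenteredConfig) : 0 ≤ rightmost x.1 := by
  by_contra h
  have h1 : {y : ℤ | 0 < y ∧ y ∈ x.1.1} = ∅ := by
    refine Set.eq_empty_of_forall_notMem fun y hy => ?_
    have := le_rightmost hy.2
    have := hy.1
    omega
  have h2 := (excess_centered x).symm
  rw [h1, Set.ncard_empty, Set.ncard_eq_zero (x.1.finite_holes 0)] at h2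
  exact Set.notMem_empty (0 : ℤ) (h2 ▸ ⟨le_rfl, fun h3 => h (le_rightmost h3)⟩)

/-- Centring gives `leftmost ≤ 1` and `rightmost ≥ 0`, so width at most `n` confines the nontrivial
part to `[-n, n]`, and the trace there determines the configuration. -/
theorem finite_width_le (n : ℕ) : {x : CenteredConfig | width x.1 ≤ n}.Finite := by
  refine Set.Finite.of_finite_image (f := fun x : CenteredConfig => x.1.1 ∩ Set.Icc (-n : ℤ) n)
    ((Set.finite_Icc (-n : ℤ) n).finite_subsets.subset ?_) ?_
  · rintro _ ⟨x, -, rfl⟩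
    exact Set.inter_subset_right
  · have key : ∀ x : CenteredConfig, width x.1 ≤ n → ∀ y, y ∈ x.1.1 ↔
        y < -n ∨ y ∈ x.1.1 ∩ Set.Icc (-n : ℤ) n := by
      intro x hx y
      have h1 := width_eq x.1
      have h2 := leftmost_centered_le x
      have h3 := le_rightmost_centered x
      constructor
      · intro h
        have := le_rightmost h
        by_cases hy : y < -n
        · exact Or.inl hy
        · exact Or.inr ⟨h, by omega, by omega⟩
      · rintro (h | h)
        · by_contra hy
          have := leftmost_le hy
          omega
        · exact h.1
    intro x hx z hz hxz
    refine Subtype.ext (Config.ext' fun y => ?_)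
    simp only at hxz
    rw [key x hx, key z hz, hxz]

theorem finite_area_le (n : ℕ) : {x : CenteredConfig | area x.1 ≤ n}.Finite :=
  (finite_width_le (2 * n)).subset fun x hx =>
    (width_le x.1).trans (Nat.mul_le_mul_left 2 hx)

theorem centered_eq_of_area_eq_zero {x z : CenteredConfig} (hx : area x.1 = 0)
    (hz : area z.1 = 0) : x = z := by
  have key : ∀ x : CenteredConfig, area x.1 = 0 → ∀ y, y ∈ x.1.1 ↔ y ≤ 0 := by
    intro x hx
    have h1 := width_le x.1
    have h2 := width_eq x.1
    have h3 := leftmost_centered_le x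
    have h4 := le_rightmost_centered x
    intro y
    constructor
    · intro hy
      have := le_rightmost hy
      omega
    · intro hy
      by_contra h
      have := leftmost_le h
      omega
  exact Subtype.ext (Config.ext' fun y => by rw [key x hx, key z hz])

theorem area_seenFromMedian (η : Config) : area (seenFromMedian η).1 = area η :=
  area_translate _ _

theorem exists_area_eq_zero : ∃ x : CenteredConfig, area x.1 = 0 := by
  let η : Config := ⟨Set.Iic 0, (Set.finite_singleton 0).subset fun x hx =>
    le_antisymm hx.2 hx.1, Set.finite_empty.subset fun x hx => hx.2 hx.1⟩
  refine ⟨seenFromMedian η, ?_⟩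
  rw [area_seenFromMedian, area, Set.ncard_eq_zero (finite_inversions η)]
  refine Set.eq_empty_of_forall_notMem fun p hp => hp.2.1 ?_
  exact hp.1.le.trans hp.2.2

theorem area_death_lt {η : Config} (h : area η ≠ 0) : area (death η) < area η := by
  obtain ⟨p, hp⟩ := Set.nonempty_of_ncard_ne_zero h
  have h1 : innerHoles η ⊆ Set.Icc (leftmost η) (rightmost η) := fun x hx =>
    ⟨leftmost_le hx.2, hx.1.le⟩
  have h2 : 0 < (innerHoles η).ncard :=
    (Set.ncard_pos ((Set.finite_Icc _ _).subset h1)).2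
      ⟨p.1, hp.1.trans_le (le_rightmost hp.2.2), hp.2.1⟩
  have := area_death η
  omega

instance : DiscreteMeasurableSpace Config := ⟨fun _ => trivial⟩

instance : DiscreteMeasurableSpace CenteredConfig := ⟨fun _ => trivial⟩

/-! ### The jump rates -/

theorem finite_setOf_exchange_ne (η : Config) : {x : ℤ | exchange η x ≠ η}.Finite := by
  refine (Set.finite_Icc (leftmost η - 1) (rightmost η)).subset fun x hx => ?_
  rw [Set.mem_ofPred_eq, Ne, exchange_eq_self_iff] at hx
  by_cases h : x ∈ η.1
  · exact upSites_subset ⟨h, fun h' => hx ⟨fun _ => h', fun _ => h⟩⟩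
  · exact downSites_subset ⟨h, by_contra fun h' => hx ⟨fun h'' => absurd h'' h,
      fun h'' => absurd h'' h'⟩⟩

/-- The jump rates as a sum over the possible transitions. -/
theorem jumpRate_eq {J : ℝ} (hJ : 0 ≤ J) {η ζ : Config} (h : ζ ≠ η) : jumpRate J η ζ =
    (∑' x : ℤ, if exchange η x = ζ then 2⁻¹ else 0) +
      (if death η = ζ then ENNReal.ofReal J else 0) +
      (if birth η = ζ then ENNReal.ofReal J else 0) := by
  have h1 : ∀ x : ℤ, (1 / 2 : ℝ) * ((if exchange η x = ζ then 1 else 0) - if η = ζ then 1 else 0) =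
      if exchange η x = ζ then 1 / 2 else 0 := by
    intro x
    rw [if_neg h.symm, sub_zero]
    split_ifs <;> norm_num
  have h2 : ∀ x : ℤ, (0 : ℝ) ≤ if exchange η x = ζ then 1 / 2 else 0 := fun x => by
    split_ifs <;> norm_num
  have h3 : Summable fun x : ℤ => if exchange η x = ζ then (1 / 2 : ℝ) else 0 := by
    refine summable_of_hasFiniteSupport ((finite_setOf_exchange_ne η).subset fun x hx => ?_)
    rw [Function.mem_support, ne_eq, ite_eq_right_iff, Classical.not_imp] at hx
    exact fun h' => h (hx.1.symm.trans h')
  have h4 : ENNReal.ofReal (1 / 2) = 2⁻¹ := by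
    rw [one_div, ENNReal.ofReal_inv_of_pos two_pos, ENNReal.ofReal_ofNat]
  rw [jumpRate, if_neg h, generator, exclusionGenerator, deathGenerator, birthGenerator]
  simp only [h1]
  rw [if_neg h.symm, sub_zero, sub_zero, ENNReal.ofReal_add, ENNReal.ofReal_add,
    ENNReal.ofReal_tsum_of_nonneg h2 h3]
  · simp only [apply_ite ENNReal.ofReal, ENNReal.ofReal_zero, mul_ite, mul_one, mul_zero, h4]
  · exact tsum_nonneg h2
  · positivity
  · exact add_nonneg (tsum_nonneg h2) (by positivity)
  · positivity

/-- Action of the jump rates on a function. -/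
theorem tsum_jumpRate_mul {J : ℝ} (hJ : 0 ≤ J) (η : Config) (g : Config → ℝ≥0∞) :
    ∑' ζ, jumpRate J η ζ * g ζ =
      (∑' x : ℤ, if exchange η x = η then 0 else 2⁻¹ * g (exchange η x)) +
        ENNReal.ofReal J * g (death η) + ENNReal.ofReal J * g (birth η) := by
  have h1 : ∀ ζ, jumpRate J η ζ * g ζ =
      (∑' x : ℤ, if ζ = exchange η x then (if exchange η x = η then 0
          else 2⁻¹ * g (exchange η x)) else 0) +
        (if ζ = death η then ENNReal.ofReal J * g (death η) else 0) +
        (if ζ = birth η then ENNReal.ofReal J * g (birth η) else 0) := by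
    intro ζ
    by_cases h : ζ = η
    · subst h
      rw [jumpRate, if_pos rfl, zero_mul, if_neg (death_ne ζ).symm, if_neg (birth_ne ζ).symm]
      symm
      simp only [add_zero, ENNReal.tsum_eq_zero]
      intro x
      split_ifs with h1 h2
      · rfl
      · exact absurd h1.symm h2
      · rfl
    · rw [jumpRate_eq hJ h, add_mul, add_mul, ← ENNReal.tsum_mul_right]
      congr 1
      · congr 1
        · refine tsum_congr fun x => ?_
          by_cases hx : exchange η x = ζ
          · subst hx
            rw [if_pos rfl, if_pos rfl, if_neg h]
          · rw [if_neg hx, if_neg (Ne.symm hx), zero_mul]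
        · by_cases hx : death η = ζ
          · subst hx
            rw [if_pos rfl, if_pos rfl]
          · rw [if_neg hx, if_neg (Ne.symm hx), zero_mul]
      · by_cases hx : birth η = ζ
        · subst hx
          rw [if_pos rfl, if_pos rfl]
        · rw [if_neg hx, if_neg (Ne.symm hx), zero_mul]
  simp only [h1]
  rw [ENNReal.tsum_add, ENNReal.tsum_add, ENNReal.tsum_comm]
  simp only [tsum_ite_eq]

/-- The contribution of the exchanges, split into jumps to the right and jumps to the left. -/
theorem tsum_exchange (η : Config) (g : Config → ℝ≥0∞) (a b : ℝ≥0∞)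
    (ha : ∀ x ∈ upSites η, g (exchange η x) = a) (hb : ∀ x ∈ downSites η, g (exchange η x) = b) :
    ∑' x : ℤ, (if exchange η x = η then 0 else 2⁻¹ * g (exchange η x)) =
      2⁻¹ * (upSites η).ncard * a + 2⁻¹ * (downSites η).ncard * b := by
  have hcount : ∀ {A : Set ℤ}, A ⊆ Set.Icc (leftmost η - 1) (rightmost η) → ∀ c : ℝ≥0∞,
      ∑' x : ℤ, (if x ∈ A then c else 0) = A.ncard * c := by
    intro A hA c
    have hfin := (Set.finite_Icc _ _).subset hA
    rw [tsum_eq_sum (s := hfin.toFinset) fun x hx => if_neg fun h => hx (hfin.mem_toFinset.2 h),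
      Finset.sum_congr rfl fun x hx => if_pos (hfin.mem_toFinset.1 hx), Finset.sum_const,
      nsmul_eq_mul, Set.ncard_eq_toFinset_card A hfin]
  have h : ∀ x : ℤ, (if exchange η x = η then 0 else 2⁻¹ * g (exchange η x)) =
      (if x ∈ upSites η then 2⁻¹ * a else 0) + (if x ∈ downSites η then 2⁻¹ * b else 0) := by
    intro x
    have ha' := ha x
    have hb' := hb x
    simp only [upSites, downSites, Set.mem_ofPred_eq, exchange_eq_self_iff] at *
    by_cases h1 : x ∈ η.1 <;> by_cases h2 : x + 1 ∈ η.1 <;> simp_all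
  simp only [h]
  rw [ENNReal.tsum_add, hcount upSites_subset, hcount downSites_subset]
  ring

theorem exitRate_jumpRate {J : ℝ} (hJ : 0 ≤ J) (η : Config) : exitRate (jumpRate J) η =
    (downSites η).ncard + (2⁻¹ + 2 * ENNReal.ofReal J) := by
  have h := tsum_jumpRate_mul hJ η fun _ => 1
  rw [tsum_exchange η (fun _ => 1) 1 1 (fun _ _ => rfl) fun _ _ => rfl] at h
  simp only [mul_one] at h
  rw [exitRate, h, ncard_upSites]
  push_cast
  rw [mul_add, mul_one, add_right_comm (2⁻¹ * _), ← add_mul, ENNReal.inv_two_add_inv_two, one_mul]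
  ring

theorem exitRate_jumpRate_ne_top {J : ℝ} (hJ : 0 ≤ J) (η : Config) :
    exitRate (jumpRate J) η ≠ ∞ := by
  rw [exitRate_jumpRate hJ]
  finiteness

/-- Gain and loss are kept apart for `stationary_balance`; their common `downSites` term cancels
later. -/
theorem tsum_jumpRate_mul_area_gain {J : ℝ} (hJ : 0 ≤ J) (η : Config) :
    ∑' ζ, jumpRate J η ζ * (area ζ - area η : ℕ) = 2⁻¹ * (downSites η).ncard + 2⁻¹ := by
  rw [tsum_jumpRate_mul hJ η fun ζ => ((area ζ - area η : ℕ) : ℝ≥0∞),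
    tsum_exchange η (fun ζ => ((area ζ - area η : ℕ) : ℝ≥0∞)) 1 0
      (fun x hx => by rw [area_exchange_of_up hx.1 hx.2]; simp)
      (fun x hx => by rw [← area_exchange_of_down hx.1 hx.2]; simp)]
  have h1 : area (death η) - area η = 0 := by
    have := area_death η; omega
  have h2 : area (birth η) - area η = 0 := by
    have := area_birth η; omega
  rw [h1, h2, ncard_upSites]
  push_cast
  ring

theorem tsum_jumpRate_mul_area_loss {J : ℝ} (hJ : 0 ≤ J) (η : Config) :
    ∑' ζ, jumpRate J η ζ * (area η - area ζ : ℕ) =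
      2⁻¹ * (downSites η).ncard + ENNReal.ofReal J * width η := by
  rw [tsum_jumpRate_mul hJ η fun ζ => ((area η - area ζ : ℕ) : ℝ≥0∞),
    tsum_exchange η (fun ζ => ((area η - area ζ : ℕ) : ℝ≥0∞)) 0 1
      (fun x hx => by rw [area_exchange_of_up hx.1 hx.2]; simp)
      (fun x hx => by rw [← area_exchange_of_down hx.1 hx.2]; simp)]
  have h1 : area η - area (death η) = (innerHoles η).ncard := by
    have := area_death η; omega
  have h2 : area η - area (birth η) = (innerParticles η).ncard := by
    have := area_birth η; omega
  rw [h1, h2, ← ncard_inner]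
  push_cast
  ring

/-- The generator applied to the area is `1 / 2 - J * width`. -/
theorem tsum_jumpRate_mul_area {J : ℝ} (hJ : 0 ≤ J) (η : Config) :
    ∑' ζ, jumpRate J η ζ * area ζ + ENNReal.ofReal J * width η =
      exitRate (jumpRate J) η * area η + 2⁻¹ := by
  have h1 : ∑' ζ, jumpRate J η ζ * area ζ + ∑' ζ, jumpRate J η ζ * (area η - area ζ : ℕ) =
      exitRate (jumpRate J) η * area η + ∑' ζ, jumpRate J η ζ * (area ζ - area η : ℕ) := by
    rw [exitRate, ← ENNReal.tsum_mul_right, ← ENNReal.tsum_add, ← ENNReal.tsum_add]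
    refine tsum_congr fun ζ => ?_
    rw [← mul_add, ← mul_add]
    congr 1
    norm_cast
    omega
  rw [tsum_jumpRate_mul_area_gain hJ, tsum_jumpRate_mul_area_loss hJ] at h1
  have h2 : (2⁻¹ * (downSites η).ncard : ℝ≥0∞) ≠ ∞ := by finiteness
  refine (ENNReal.add_right_inj h2).1 ?_
  calc _ = _ := by ring
    _ = _ := h1
    _ = _ := by ring

/-- The particle process does not explode. -/
theorem tsum_transitionProb_jumpRate {J : ℝ} (hJ : 0 ≤ J) {t : ℝ} (ht : 0 ≤ t) (η : Config) :
    ∑' ζ, transitionProb (jumpRate J) t η ζ = 1 := by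
  refine tsum_transitionProb_eq_one (jumpRate J) (exitRate_jumpRate_ne_top hJ)
    -- In `c`, the `1` covers `downSites`, bounded by the area, and the two halves from exit rate
    -- and drift; `2 * J` covers birth and death.
    (c := 1 + 2 * J) (by positivity) (W := fun ζ => 1 + area ζ) (fun ζ => by finiteness)
    (fun ζ => ?_) ht η
  have h1 : ∑' ξ, jumpRate J ζ ξ * area ξ ≤ exitRate (jumpRate J) ζ * area ζ + 2⁻¹ :=
    le_trans (le_add_of_nonneg_right zero_le) (tsum_jumpRate_mul_area hJ ζ).le
  have h2 : exitRate (jumpRate J) ζ + 2⁻¹ ≤ ENNReal.ofReal (1 + 2 * J) * (1 + area ζ) := by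
    rw [exitRate_jumpRate hJ, ENNReal.ofReal_add zero_le_one (by positivity),
      ENNReal.ofReal_mul zero_le_two, ENNReal.ofReal_one, ENNReal.ofReal_ofNat]
    calc _ = (downSites ζ).ncard + (2⁻¹ + 2⁻¹) + 2 * ENNReal.ofReal J := by ring
      _ ≤ area ζ + 1 + 2 * ENNReal.ofReal J * (1 + area ζ) := by
        rw [ENNReal.inv_two_add_inv_two]
        refine add_le_add (add_le_add_left (Nat.cast_le.2 (ncard_downSites_le_area ζ)) _) ?_
        exact le_mul_of_one_le_right zero_le (le_add_of_nonneg_right zero_le)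
      _ = _ := by ring
  simp only [mul_add, mul_one]
  rw [ENNReal.tsum_add]
  calc _ ≤ exitRate (jumpRate J) ζ + (exitRate (jumpRate J) ζ +
        (exitRate (jumpRate J) ζ * area ζ + 2⁻¹)) := by gcongr; rfl
    _ = exitRate (jumpRate J) ζ + exitRate (jumpRate J) ζ * area ζ +
        (exitRate (jumpRate J) ζ + 2⁻¹) := by ring
    _ ≤ _ := (add_le_add_right h2 _).trans_eq (by ring)

/-! ### The process seen from the median -/

theorem tsum_jumpRate_mul_translate {J : ℝ} (hJ : 0 ≤ J) {g : Config → ℝ≥0∞}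
    (hg : ∀ y η, g (translate y η) = g η) (y : ℤ) (η : Config) :
    ∑' ζ, jumpRate J (translate y η) ζ * g ζ = ∑' ζ, jumpRate J η ζ * g ζ := by
  rw [tsum_jumpRate_mul hJ, tsum_jumpRate_mul hJ]
  simp only [exchange_translate, death_translate, birth_translate, hg,
    (translate_injective y).eq_iff]
  congr 2
  exact (Equiv.addRight y).tsum_eq fun x => if exchange η x = η then 0 else 2⁻¹ * g (exchange η x)

/-- This makes the recentred process Markov: the evolution of translation-invariant functions
depends on the starting point only up to translation. -/
theorem killedMean_translate {J : ℝ} (hJ : 0 ≤ J) {f : Config → ℝ≥0∞}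
    (hf : ∀ y η, f (translate y η) = f η) (n : ℕ) (t : ℝ) (y : ℤ) (η : Config) :
    killedMean (jumpRate J) f n t (translate y η) = killedMean (jumpRate J) f n t η := by
  induction n generalizing t y η with
  | zero => simp [killedMean, killedTransition]
  | succ n ih =>
    have hexit : exitRate (jumpRate J) (translate y η) = exitRate (jumpRate J) η := by
      have := tsum_jumpRate_mul_translate hJ (g := fun _ => 1) (fun _ _ => rfl) y η
      simpa only [mul_one, exitRate] using this
    rw [killedMean_succ, killedMean_succ, hexit, hf]
    congr 1
    refine lintegral_congr fun s => ?_
    rw [tsum_jumpRate_mul_translate hJ (g := fun z => killedMean (jumpRate J) f n (t - s) z)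
      fun y η => ih _ _ _]

theorem transitionMean_translate {J : ℝ} (hJ : 0 ≤ J) {f : Config → ℝ≥0∞}
    (hf : ∀ y η, f (translate y η) = f η) (t : ℝ) (y : ℤ) (η : Config) :
    transitionMean (jumpRate J) f t (translate y η) = transitionMean (jumpRate J) f t η := by
  simp only [transitionMean_eq_iSup, killedMean_translate hJ hf]

/-- The jump rates of the process seen from the median. A jump that only translates the
configuration counts as a jump from a state to itself. -/
noncomputable def medianRate (J : ℝ) (x z : CenteredConfig) : ℝ≥0∞ :=
  ∑' ζ, jumpRate J x.1 ζ * if seenFromMedian ζ = z then 1 else 0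

theorem tsum_medianRate_mul (J : ℝ) (x : CenteredConfig) (g : CenteredConfig → ℝ≥0∞) :
    ∑' z, medianRate J x z * g z = ∑' ζ, jumpRate J x.1 ζ * g (seenFromMedian ζ) := by
  simp only [medianRate, ← ENNReal.tsum_mul_right]
  rw [ENNReal.tsum_comm]
  refine tsum_congr fun ζ => ?_
  rw [tsum_eq_single (seenFromMedian ζ) fun z hz => by rw [if_neg hz.symm, mul_zero, zero_mul],
    if_pos rfl, mul_one]

/-- Retaining the self-jumps makes the exit rates agree exactly; they contribute equally to both
sides of the balance equations. -/
theorem exitRate_medianRate (J : ℝ) (x : CenteredConfig) :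
    exitRate (medianRate J) x = exitRate (jumpRate J) x.1 := by
  have := tsum_medianRate_mul J x fun _ => 1
  simpa only [mul_one, exitRate] using this

/-- Transition probabilities of the process seen from the median. -/
noncomputable def medianProb (J t : ℝ) (x z : CenteredConfig) : ℝ≥0∞ :=
  transitionMean (jumpRate J) (fun ζ => if seenFromMedian ζ = z then 1 else 0) t x.1

theorem medianProb_seenFromMedian {J : ℝ} (hJ : 0 ≤ J) (t : ℝ) (η : Config) (z : CenteredConfig) :
    medianProb J t (seenFromMedian η) z =
      transitionMean (jumpRate J) (fun ζ => if seenFromMedian ζ = z then 1 else 0) t η :=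
  transitionMean_translate hJ (fun y ζ => by rw [seenFromMedian_translate]) t _ η

theorem tsum_medianProb {J : ℝ} (hJ : 0 ≤ J) {t : ℝ} (ht : 0 ≤ t) (x : CenteredConfig) :
    ∑' z, medianProb J t x z = 1 := by
  simp only [medianProb, transitionMean]
  rw [ENNReal.tsum_comm]
  refine Eq.trans ?_ (tsum_transitionProb_jumpRate hJ ht x.1)
  refine tsum_congr fun ζ => ?_
  rw [ENNReal.tsum_mul_left, tsum_eq_single (seenFromMedian ζ) fun z hz => if_neg hz.symm,
    if_pos rfl, mul_one]

/-- After a jump to `ζ` the process may be continued from `seenFromMedian ζ`, so the backward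
equation closes on centred states. -/
theorem medianProb_integrated {J : ℝ} (hJ : 0 ≤ J) {t : ℝ} (ht : 0 ≤ t) (x z : CenteredConfig) :
    medianProb J t x z + ∫⁻ s in Set.Icc 0 t, exitRate (medianRate J) x * medianProb J s x z =
      (if x = z then 1 else 0) +
        ∫⁻ s in Set.Icc 0 t, ∑' y, medianRate J x y * medianProb J s y z := by
  have h := transitionMean_integrated (jumpRate J) (exitRate_jumpRate_ne_top hJ)
    (fun ζ => if seenFromMedian ζ = z then 1 else 0) ht x.1
  simp only [← medianProb_seenFromMedian hJ, seenFromMedian_centered] at h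
  simp only [exitRate_medianRate, tsum_medianRate_mul J x fun y => medianProb J _ y z]
  exact h

/-- Each death strictly lowers a positive area, and area zero singles out one centred configuration.
-/
theorem medianProb_ne_zero {J : ℝ} (hJ : 0 < J) {o : CenteredConfig} (ho : area o.1 = 0) {t : ℝ}
    (ht : 0 < t) (x : CenteredConfig) : medianProb J t x o ≠ 0 := by
  have key : ∀ (n : ℕ) (η : Config), area η = n → ∀ t, 0 < t →
      transitionMean (jumpRate J) (fun ζ => if seenFromMedian ζ = o then 1 else 0) t η ≠ 0 := by
    intro n
    induction n using Nat.strong_induction_on with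
    | _ n ih =>
      intro η hη t ht
      by_cases hn : area η = 0
      · refine transitionMean_ne_zero_of_ne_zero ?_ t
        rw [if_pos (centered_eq_of_area_eq_zero ((area_seenFromMedian η).trans hn) ho)]
        exact one_ne_zero
      · refine transitionMean_ne_zero_of_jump (z := death η) ?_
          (ih _ (hη ▸ area_death_lt hn) _ rfl) ht
        rw [jumpRate_eq hJ.le (death_ne η), if_pos rfl]
        have := ENNReal.ofReal_pos.2 hJ
        exact (this.trans_le ((le_add_of_nonneg_left zero_le).trans
          (le_add_of_nonneg_right zero_le))).ne'
  exact key _ x.1 rfl t ht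

/-! ### From transition matrices to measures, and the stationary law. -/

theorem particleLaw_apply (J t : ℝ) (η : Config) (A : Set Config) :
    particleLaw J t η A = ∑' ζ, transitionProb (jumpRate J) t η ζ * if ζ ∈ A then 1 else 0 := by
  rw [particleLaw, Measure.sum_apply _ .of_discrete]
  refine tsum_congr fun ζ => ?_
  rw [Measure.smul_apply, Measure.dirac_apply' _ .of_discrete, smul_eq_mul]
  rfl

theorem isProbabilityMeasure_particleLaw {J : ℝ} (hJ : 0 ≤ J) {t : ℝ} (ht : 0 ≤ t) (η : Config) :
    IsProbabilityMeasure (particleLaw J t η) := by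
  refine ⟨?_⟩
  rw [particleLaw_apply]
  simpa using tsum_transitionProb_jumpRate hJ ht η

theorem medianKernel_singleton (J t : ℝ) (x z : CenteredConfig) :
    medianKernel J t x {z} = medianProb J t x z := by
  change (particleLaw J t x.1).map seenFromMedian {z} = _
  rw [Measure.map_apply measurable_from_top .of_discrete, particleLaw_apply]
  rfl

theorem invariant_iff (J t : ℝ) (μ : Measure CenteredConfig) : (medianKernel J t).Invariant μ ↔
    ∀ z, ∑' x, μ {x} * medianProb J t x z = μ {z} := by
  rw [Kernel.Invariant, Measure.ext_iff_singleton]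
  refine forall_congr' fun z => ?_
  rw [Measure.bind_apply .of_discrete (Kernel.measurable _).aemeasurable, lintegral_countable']
  simp only [medianKernel_singleton, mul_comm]

/-- The area serves as Lyapunov function and the width as the dissipation, which also dominates the
exit rate up to a constant. -/
theorem exists_stationary_medianRate {J : ℝ} (hJ : 0 < J) :
    ∃ π : CenteredConfig → ℝ≥0∞, ∑' x, π x = 1 ∧
      (∀ y, ∑' x, π x * medianRate J x y = π y * exitRate (medianRate J) y) ∧
      ∑' x, π x * exitRate (medianRate J) x ≠ ∞ := by
  have : Nonempty CenteredConfig := ⟨exists_area_eq_zero.choose⟩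
  refine exists_stationary (V := fun x => area x.1) (κ := ENNReal.ofReal J) (b := 2⁻¹)
    (C := 2⁻¹ + 2 * ENNReal.ofReal J) (fun x => ?_) finite_area_le finite_width_le ?_ (by simp)
    (by finiteness) (fun x => ?_) fun x => ?_
  · rw [exitRate_medianRate]
    exact exitRate_jumpRate_ne_top hJ.le _
  · exact (ENNReal.ofReal_pos.2 hJ).ne'
  · rw [tsum_medianRate_mul J x fun z => (area z.1 : ℝ≥0∞), exitRate_medianRate]
    simp only [area_seenFromMedian]
    exact (tsum_jumpRate_mul_area hJ.le x.1).le
  · rw [exitRate_medianRate, exitRate_jumpRate hJ.le]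
    gcongr
    exact ncard_downSites_le_width x.1

/-- Stationarity of the mean area determines the mean width. -/
theorem stationary_mean_width {J : ℝ} (hJ : 0 < J) {π : CenteredConfig → ℝ≥0∞}
    (hπ1 : ∑' x, π x = 1)
    (hπ : ∀ y, ∑' x, π x * medianRate J x y = π y * exitRate (medianRate J) y)
    (hfin : ∑' x, π x * exitRate (medianRate J) x ≠ ∞) :
    ∑' x, π x * width x.1 = ENNReal.ofReal (1 / (2 * J)) := by
  have h := stationary_balance hπ hfin fun x => area x.1
  simp only [fun x => tsum_medianRate_mul J x fun z => ((area z.1 - area x.1 : ℕ) : ℝ≥0∞),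
    fun x => tsum_medianRate_mul J x fun z => ((area x.1 - area z.1 : ℕ) : ℝ≥0∞),
    area_seenFromMedian, tsum_jumpRate_mul_area_gain hJ.le, tsum_jumpRate_mul_area_loss hJ.le,
    mul_add, ENNReal.tsum_add] at h
  -- The exclusion term common to gain and loss is finite by the mean exit rate; cancelling it
  -- leaves `1/2` equal to `J` times the mean width.
  have hne : ∑' x : CenteredConfig, π x * (2⁻¹ * (downSites x.1).ncard) ≠ ∞ := by
    refine ne_top_of_le_ne_top hfin (ENNReal.tsum_le_tsum fun x => ?_)
    rw [exitRate_medianRate, exitRate_jumpRate hJ.le]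
    gcongr
    refine le_trans (mul_le_of_le_one_left zero_le ?_) (le_add_of_nonneg_right zero_le)
    exact ENNReal.inv_le_one.2 one_le_two
  rw [ENNReal.add_right_inj hne, ENNReal.tsum_mul_right, hπ1, one_mul] at h
  have hJ0 : ENNReal.ofReal J ≠ 0 := (ENNReal.ofReal_pos.2 hJ).ne'
  simp only [mul_left_comm (π _), ENNReal.tsum_mul_left] at h
  have h2 : ENNReal.ofReal (1 / (2 * J)) = 2⁻¹ * (ENNReal.ofReal J)⁻¹ := by
    rw [one_div, mul_inv, ENNReal.ofReal_mul (by norm_num), ENNReal.ofReal_inv_of_pos two_pos,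
      ENNReal.ofReal_inv_of_pos hJ, ENNReal.ofReal_ofNat]
  rw [h2, h, mul_comm, ← mul_assoc, ENNReal.inv_mul_cancel hJ0 ENNReal.ofReal_ne_top, one_mul]

end FreeBoundary

/-! ### The main theorem. -/

open FreeBoundary in
theorem mainTheorem5 (J : ℝ) (hJ : 0 < J) :
    (∀ t : ℝ, 0 ≤ t → ∀ η : FreeBoundary.Config,
      IsProbabilityMeasure (FreeBoundary.particleLaw J t η)) ∧
    ∃ μ : Measure FreeBoundary.CenteredConfig,
      FreeBoundary.IsInvariantProbability J μ ∧
      (∀ ν : Measure FreeBoundary.CenteredConfig,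
        FreeBoundary.IsInvariantProbability J ν → ν = μ) ∧
      Integrable (fun η : FreeBoundary.CenteredConfig =>
        ((FreeBoundary.rightmost η.1 - FreeBoundary.leftmost η.1 + 1 : ℤ) : ℝ)) μ ∧
      ∫ η : FreeBoundary.CenteredConfig,
        ((FreeBoundary.rightmost η.1 - FreeBoundary.leftmost η.1 + 1 : ℤ) : ℝ) ∂μ
          = 1 / (2 * J) := by
  refine ⟨fun t ht η => isProbabilityMeasure_particleLaw hJ.le ht η, ?_⟩
  obtain ⟨π, hπ1, hπ, hfin⟩ := exists_stationary_medianRate hJ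
  let μ : Measure CenteredConfig := Measure.sum fun x => π x • Measure.dirac x
  have hμ : ∀ x, μ {x} = π x := by
    intro x
    rw [Measure.sum_apply _ .of_discrete, tsum_eq_single x fun y hy => ?_]
    · rw [Measure.smul_apply, Measure.dirac_apply' _ .of_discrete]
      simp
    · rw [Measure.smul_apply, Measure.dirac_apply' _ .of_discrete]
      simp [hy]
  have hmass : ∀ ρ : Measure CenteredConfig, ρ Set.univ = ∑' x, ρ {x} := by
    intro ρ
    rw [← lintegral_one, lintegral_countable']
    simp
  have hprob : IsProbabilityMeasure μ := ⟨by rw [hmass]; simp only [hμ, hπ1]⟩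
  have hinv : ∀ t : ℝ, 0 ≤ t → (medianKernel J t).Invariant μ := by
    intro t ht
    rw [invariant_iff]
    intro z
    simp only [hμ]
    rw [stationary_invariant hπ hfin (f := fun x => if x = z then 1 else 0)
      (w := fun t x => medianProb J t x z) (fun x => measurable_transitionMean _ _ _)
      (fun t ht x => ?_) fun x => medianProb_integrated hJ.le ht x z]
    · rw [tsum_eq_single z fun x hx => by rw [if_neg hx, mul_zero], if_pos rfl, mul_one]
    · rw [← tsum_medianProb hJ.le ht x]
      exact ENNReal.le_tsum z
  have hwidth : ∀ x : CenteredConfig,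
      ((rightmost x.1 - leftmost x.1 + 1 : ℤ) : ℝ) = (width x.1 : ℝ) := by
    intro x
    rw [← width_eq, Int.cast_natCast]
  have hlint : ∫⁻ x, ENNReal.ofReal (width x.1 : ℝ) ∂μ = ENNReal.ofReal (1 / (2 * J)) := by
    rw [lintegral_countable', ← stationary_mean_width hJ hπ1 hπ hfin]
    simp only [hμ, ENNReal.ofReal_natCast, mul_comm]
  refine ⟨μ, ⟨hprob, hinv⟩, fun ν hν => ?_, ?_, ?_⟩
  · obtain ⟨o, ho⟩ := exists_area_eq_zero
    have := hν.1
    have huniq := invariant_unique (ι := {t : ℝ // 0 ≤ t})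
      (P := fun t x z => medianProb J t.1 x z) (fun t x => tsum_medianProb hJ.le t.2 x) (o := o)
      -- Any positive time would do in place of `1`.
      (fun x => ⟨⟨1, zero_le_one⟩, medianProb_ne_zero hJ ho one_pos x⟩)
      (μ := fun x => ν {x}) (ν := fun x => μ {x})
      (by rw [← hmass, measure_univ]) (by rw [← hmass, measure_univ])
      (fun t => (invariant_iff J t.1 ν).1 (hν.2 t.1 t.2))
      (fun t => (invariant_iff J t.1 μ).1 (hinv t.1 t.2))
    exact Measure.ext_iff_singleton.2 fun x => congrFun huniq x
  · simp only [hwidth]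
    refine ⟨measurable_from_top.aestronglyMeasurable, ?_⟩
    rw [hasFiniteIntegral_iff_ofReal (Filter.Eventually.of_forall fun x => Nat.cast_nonneg _), hlint]
    exact ENNReal.ofReal_lt_top
  · simp only [hwidth]
    rw [integral_eq_lintegral_of_nonneg_ae (Filter.Eventually.of_forall fun x => Nat.cast_nonneg _)
      measurable_from_top.aestronglyMeasurable, hlint, ENNReal.toReal_ofReal (by positivity)]
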